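/- Let $n\ge 1$. A cube $Q\subset\mathbb R^n$ is an open cube with sides parallel to the axes, of side length $\ell(Q)>0$; $|E|$ denotes Lebesgue measure. A weight is a nonnegative locally integrable function $\omega$ on $\mathbb R^n$ with $\omega>0$ almost everywhere; write $\omega(E)=\int_E\omega\,dx$ and $\mathrm{Avg}_Q\,\omega=\omega(Q)/|Q|$. For $0<\rho<\infty$ put $$[\omega]_{A^{\rm loc}_{p;\rho}}=\sup_{\ell(Q)\le\rho}\Big(\frac1{|Q|}\int_Q\omega\,dx\Big)\Big(\frac1{|Q|}\int_Q\omega^{-\frac1{p-1}}dx\Big)^{p-1}\ (1<p<\infty),\qquad [\omega]_{A^{\rm loc}_{1;\rho}}=\sup_{\ell(Q)\le\rho}\Big(\frac1{|Q|}\int_Q\omega\,dx\Big)\|\omega^{-1}\|_{L^\infty(Q)},$$ $$[\omega]_{A^{\rm loc}_{\infty;\rho}}=\sup_{\ell(Q)\le\rho}\Big(\frac1{|Q|}\int_Q\omega\,dx\Big)\exp\Big(\frac1{|Q|}\int_Q\log\omega^{-1}dx\Big)$$ (the last integral takes values in $(-\infty,\infty]$, and $\exp\infty=\infty$), and for $1\le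 p\le\infty$ let $A^{\rm loc}_{p;\rho}$ be the class of weights $\omega$ with $[\omega]_{A^{\rm loc}_{p;\rho}}<\infty$, and $A^{\rm loc}_p=A^{\rm loc}_{p;1}$. **Theorem.** Let $0<\rho<\infty$ and let $\omega$ be a weight. Then $\omega\in A^{\rm loc}_{\infty;\rho}$ if and only if any one of the following conditions holds (that is, all of them are equivalent to each other and to $\omega\in A^{\rm loc}_{\infty;\rho}$). 1. There exist $0<\gamma,\delta<1$ such that $|\{x\in Q:\omega(x)\le\gamma\,\mathrm{Avg}_Q\,\omega\}|\le\delta|Q|$ for all cubes $Q$ with $\ell(Q)\le\rho$. 2. There exist $0<\alpha,\beta<1$ such that for all cubes $Q$ with $\ell(Q)\le\rho$ and all measurable $A\subseteq Q$: $|A|\le\alpha|Q|$ entails $\omega(A)\le\beta\,\omega(Q)$. 3. There exist $0<C_1,\varepsilon<\infty$ such that for all cubes $Q$ with $\ell(Q)\le\rho$: $\Big(\frac1{|Q|}\int_Q\omega^{1+\varepsilon}dx\Big)^{\frac1{1+\varepsilon}}\le\frac{C_1}{|Q|}\int_Q\omega\,dx$. 4. There exist $0<C_2,\varepsilon_0<\infty$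 such that for all cubes $Q$ with $\ell(Q)\le\rho$ and all measurable $A\subseteq Q$: $\frac{\omega(A)}{\omega(Q)}\le C_2\big(\frac{|A|}{|Q|}\big)^{\varepsilon_0}$. 5. There exist $0<\alpha',\beta'<1$ such that for all cubes $Q$ with $\ell(Q)\le\rho$ and all measurable $A\subseteq Q$: $\omega(A)<\alpha'\omega(Q)$ entails $|A|<\beta'|Q|$. 6. There exist $1\le p<\infty$ and $C_3<\infty$ such that $[\omega]_{A^{\rm loc}_{p;\rho}}\le C_3$; equivalently, $\omega\in A^{\rm loc}_p$ for some $1\le p<\infty$. Hence $A^{\rm loc}_{\infty;\rho}=A^{\rm loc}_\infty$ for every $0<\rho<\infty$, and $A^{\rm loc}_\infty=\bigcup_{1\le p<\infty}A^{\rm loc}_p$. -/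

import Mathlib

open MeasureTheory

namespace LocalMuckenhoupt

/-- The open cube in `ℝⁿ` with sides parallel to the axes, center `c` and side length `l`. -/
def cube {n : ℕ} (c : Fin n → ℝ) (l : ℝ) : Set (Fin n → ℝ) :=
  {x | ∀ i, |x i - c i| < l / 2}

/-- For `l > 0`, cubes are the balls of the supremum norm of `Fin n → ℝ`. -/
theorem cube_eq_ball {n : ℕ} (c : Fin n → ℝ) {l : ℝ} (hl : 0 < l) :
    cube c l = Metric.ball c (l / 2) := by
  ext x
  simp [cube, dist_pi_lt_iff (half_pos hl), Real.dist_eq]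

/-- `IsCubeUpTo ρ Q`: the set `Q` is an open cube of side length at most `ρ`. -/
def IsCubeUpTo {n : ℕ} (ρ : ℝ) (Q : Set (Fin n → ℝ)) : Prop :=
  ∃ (c : Fin n → ℝ) (l : ℝ), 0 < l ∧ l ≤ ρ ∧ Q = cube c l

/-- A weight: a nonnegative, locally integrable (in particular Lebesgue measurable) function
on `ℝⁿ` that is positive almost everywhere. -/
structure IsWeight {n : ℕ} (ω : (Fin n → ℝ) → ℝ) : Prop where
  nonneg : ∀ x, 0 ≤ ω x
  locallyIntegrable : LocallyIntegrable ω volume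
  ae_pos : ∀ᵐ x ∂(volume : Measure (Fin n → ℝ)), 0 < ω x

/-- `ω(E) = ∫_E ω(x) dx`, with values in `[0, ∞]`. -/
noncomputable def wt {n : ℕ} (ω : (Fin n → ℝ) → ℝ) (E : Set (Fin n → ℝ)) : ENNReal :=
  ∫⁻ x in E, ENNReal.ofReal (ω x)

/-- The average of `ω` over `E`, with values in `[0, ∞]`. -/
noncomputable def avg {n : ℕ} (ω : (Fin n → ℝ) → ℝ) (E : Set (Fin n → ℝ)) : ENNReal :=
  wt ω E / volume E

/-- The local Muckenhoupt constant of exponent `p` (meant for `1 ≤ p < ∞`) at scale `ρ`. Real powers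
and inverses are taken in `[0, ∞]`, so that nothing is lost where an integral diverges. -/
noncomputable def apConst {n : ℕ} (p ρ : ℝ) (ω : (Fin n → ℝ) → ℝ) : ENNReal :=
  ⨆ (Q : Set (Fin n → ℝ)) (_ : IsCubeUpTo ρ Q),
    if p = 1 then
      avg ω Q * essSup (fun x => (ENNReal.ofReal (ω x))⁻¹) (volume.restrict Q)
    else
      avg ω Q *
        ((∫⁻ x in Q, ENNReal.ofReal (ω x) ^ (-(1 / (p - 1)))) / volume Q) ^ (p - 1)

/-- The class `A_{p;ρ}^loc`. -/
def ApLocAt (n : ℕ) (p ρ : ℝ) : Set ((Fin n → ℝ) → ℝ) :=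
  {ω | IsWeight ω ∧ apConst p ρ ω < ⊤}

/-- The class `A_p^loc`, that is, `A_{p;1}^loc`. -/
def ApLoc (n : ℕ) (p : ℝ) : Set ((Fin n → ℝ) → ℝ) :=
  ApLocAt n p 1

open Classical in
/-- `exp (|Q|⁻¹ ∫_Q log ω(x)⁻¹ dx)`, with values in `[0, ∞]`. For a weight `ω` and a cube `Q` the
negative part of `log ω⁻¹` is integrable on `Q`, so the integral makes sense in `(-∞, ∞]`, and it
is `∞` exactly when `log ω⁻¹` is not integrable on `Q` (see `lintegral_log_inv_eq_top`). -/
noncomputable def expAvgLogInv {n : ℕ} (ω : (Fin n → ℝ) → ℝ) (Q : Set (Fin n → ℝ)) : ENNReal :=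
  if IntegrableOn (fun x => Real.log (ω x)⁻¹) Q volume then
    ENNReal.ofReal (Real.exp ((volume.real Q)⁻¹ * ∫ x in Q, Real.log (ω x)⁻¹))
  else ⊤

/-- The constant of the class `A_{∞;ρ}^loc`. -/
noncomputable def aInftyConst {n : ℕ} (ρ : ℝ) (ω : (Fin n → ℝ) → ℝ) : ENNReal :=
  ⨆ (Q : Set (Fin n → ℝ)) (_ : IsCubeUpTo ρ Q), avg ω Q * expAvgLogInv ω Q

/-- The class `A_{∞;ρ}^loc`. -/
def AInftyLocAt (n : ℕ) (ρ : ℝ) : Set ((Fin n → ℝ) → ℝ) :=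
  {ω | IsWeight ω ∧ aInftyConst ρ ω < ⊤}

/-- The class `A_∞^loc`, that is, `A_{∞;1}^loc`. -/
def AInftyLoc (n : ℕ) : Set ((Fin n → ℝ) → ℝ) :=
  AInftyLocAt n 1

/-- For a weight, the negative part of `log ω⁻¹` has finite integral on every cube, and if
`log ω⁻¹` is not integrable there then its positive part has infinite integral. -/
theorem lintegral_log_inv_eq_top {n : ℕ} {ρ : ℝ} {ω : (Fin n → ℝ) → ℝ} (hω : IsWeight ω)
    {Q : Set (Fin n → ℝ)} (hQ : IsCubeUpTo ρ Q) :
    (∫⁻ x in Q, ENNReal.ofReal (-Real.log (ω x)⁻¹)) < ⊤ ∧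
      (¬ IntegrableOn (fun x => Real.log (ω x)⁻¹) Q volume →
        (∫⁻ x in Q, ENNReal.ofReal (Real.log (ω x)⁻¹)) = ⊤) := by
  obtain ⟨c, l, hl, -, rfl⟩ := hQ
  have hint : IntegrableOn ω (cube c l) volume := by
    rw [cube_eq_ball c hl]
    exact (hω.locallyIntegrable.integrableOn_isCompact
      (isCompact_closedBall c (l / 2))).mono_set Metric.ball_subset_closedBall
  have hneg : (∫⁻ x in cube c l, ENNReal.ofReal (-Real.log (ω x)⁻¹)) < ⊤ := by
    refine lt_of_le_of_lt (lintegral_mono fun x => ?_) hint.lintegral_lt_top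
    refine ENNReal.ofReal_le_ofReal ?_
    rw [Real.log_inv, neg_neg]
    exact Real.log_le_self (hω.nonneg x)
  refine ⟨hneg, fun hni => ?_⟩
  by_contra htop
  have hmeas : AEMeasurable (fun x => Real.log (ω x)⁻¹) (volume.restrict (cube c l)) :=
    Real.measurable_log.comp_aemeasurable hint.aestronglyMeasurable.aemeasurable.inv
  refine hni ⟨hmeas.aestronglyMeasurable, ?_⟩
  rw [hasFiniteIntegral_iff_norm]
  calc (∫⁻ x in cube c l, ENNReal.ofReal ‖Real.log (ω x)⁻¹‖)
      ≤ ∫⁻ x in cube c l,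
          (ENNReal.ofReal (Real.log (ω x)⁻¹) + ENNReal.ofReal (-Real.log (ω x)⁻¹)) := by
        refine lintegral_mono fun x => ?_
        rcases le_total 0 (Real.log (ω x)⁻¹) with h | h
        · rw [Real.norm_of_nonneg h]
          exact le_self_add
        · rw [Real.norm_of_nonpos h]
          exact le_add_self
    _ = _ := lintegral_add_left' hmeas.ennreal_ofReal _
    _ < ⊤ := ENNReal.add_lt_top.2 ⟨lt_top_iff_ne_top.2 htop, hneg⟩

end LocalMuckenhoupt

open LocalMuckenhoupt

/-!
The conditions are proved equivalent along the cycle `A_∞ ⇒` sublevel sets `⇒` small Lebesgue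
proportion forces weighted proportion away from `1` `⇒` reverse Hölder `⇒` power bound `⇒` small
weighted proportion forces Lebesgue proportion away from `1` `⇒ A_p ⇒ A_∞`, all at one scale `ρ`.

The two substantial steps are the reverse Hölder inequality and the step to `A_p`. Both are
instances of a single self-improvement principle for two measures `μ`, `ν` on a nested sequence of
countable partitions, `IsNested.exists_lintegral_rpow_le`. Suppose that `μ` is doubling along the partitions
and that small `μ`-proportion of a cell forces `ν`-proportion at most `β < 1`. A Calderón-Zygmund
stopping time selects the first cells on which `ν / μ` exceeds a height `t`; the union of the
selected cells is the superlevel set of the maximal function of `ν / μ`. Raising the height by a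
large fixed factor leaves only a small `μ`-proportion of each selected cell
(`IsNested.mul_measure_maxSet_inter_cell_le`), so the `ν`-measure of the superlevel sets decays
geometrically (`IsNested.measure_maxSet_le`), and a small power of `dν / dμ` is `ν`-integrable.
The partitions are those of a cube into half-open dyadic subcubes, and Lebesgue's differentiation
theorem bounds the density by the maximal function (`IsWeight.ae_tendsto_avg_cell`).
With `μ = dx` and `ν = ω dx` this is the reverse Hölder inequality. With `μ = ω dx` and `ν = dx` the
density is `ω⁻¹`, and the conclusion is the `A_p` condition for some `p > 1`; the doubling property
of `ω dx` comes from a finite chain of cubes (`SmallWeightBoundsVolume.exists_doubling`).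

The remaining steps are direct: Chebyshev's inequality for `u - 1 - log u` with `u = ω / Avg ω`,
Hölder's inequality, passing to complements, and Jensen's inequality for the exponential function.

Independence of the scale rests on the power bound: on a large cube it follows by summation over the
small dyadic subcubes (`HasPowerBound.change_scale`). Running the cycle at the scales `ρ` and `1`
then identifies `A_{∞;ρ}` with the union of the classes `A_p` at scale `1`.
-/

namespace LocalMuckenhoupt

open Filter Topology ENNReal

/-! ### Nested partitions and the stopping-time argument -/

section Nested

variable {Ω ι : Type*}

/-- The cell of level `m` containing `x`, for the partitions of `Ω` into the fibres of `π m`. -/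
def cell (π : ℕ → Ω → ι) (m : ℕ) (x : Ω) : Set Ω := {y | π m y = π m x}

/-- The fibres of the labelling maps `π m` are measurable, and those of `π (m + 1)` refine those
of `π m`. -/
structure IsNested [MeasurableSpace Ω] (π : ℕ → Ω → ι) : Prop where
  measurableSet_fiber : ∀ m z, MeasurableSet (π m ⁻¹' {z})
  succ : ∀ m x y, π (m + 1) x = π (m + 1) y → π m x = π m y

theorem mem_cell_self (π : ℕ → Ω → ι) (m : ℕ) (x : Ω) : x ∈ cell π m x := rfl

theorem cell_congr {π : ℕ → Ω → ι} {m : ℕ} {x y : Ω} (h : π m x = π m y) :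
    cell π m x = cell π m y := by
  simp [cell, h]

/-- A set which is a union of cells of level `m`. -/
def IsCellUnion (π : ℕ → Ω → ι) (m : ℕ) (E : Set Ω) : Prop :=
  ∀ x ∈ E, cell π m x ⊆ E

theorem IsCellUnion.inter {π : ℕ → Ω → ι} {m : ℕ} {E F : Set Ω} (hE : IsCellUnion π m E)
    (hF : IsCellUnion π m F) : IsCellUnion π m (E ∩ F) :=
  fun x hx => Set.subset_inter (hE x hx.1) (hF x hx.2)

theorem IsCellUnion.eq_preimage {π : ℕ → Ω → ι} {m : ℕ} {E : Set Ω} (hE : IsCellUnion π m E) :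
    E = π m ⁻¹' (π m '' E) := by
  refine Set.Subset.antisymm (Set.subset_preimage_image _ _) ?_
  rintro y ⟨x, hx, hxy⟩
  exact hE x hx hxy.symm

variable [MeasurableSpace Ω] {π : ℕ → Ω → ι}

theorem IsNested.eq_of_le (hπ : IsNested π) {j m : ℕ} (hjm : j ≤ m) {x y : Ω}
    (h : π m x = π m y) : π j x = π j y := by
  induction m, hjm using Nat.le_induction with
  | base => exact h
  | succ m _ ih => exact ih (hπ.succ m x y h)

theorem IsNested.measurableSet_cell (hπ : IsNested π) (m : ℕ) (x : Ω) :
    MeasurableSet (cell π m x) :=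
  hπ.measurableSet_fiber m (π m x)

theorem IsNested.cell_subset (hπ : IsNested π) {j m : ℕ} (hjm : j ≤ m) (x : Ω) :
    cell π m x ⊆ cell π j x :=
  fun _ hy => hπ.eq_of_le hjm hy

theorem IsNested.isCellUnion_cell (hπ : IsNested π) {j m : ℕ} (hjm : j ≤ m) (x : Ω) :
    IsCellUnion π m (cell π j x) := fun _ hy _ hz =>
  (hπ.eq_of_le hjm hz).trans hy

theorem IsCellUnion.measurableSet [Countable ι] (hπ : IsNested π) {m : ℕ} {E : Set Ω}
    (hE : IsCellUnion π m E) : MeasurableSet E := by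
  rw [hE.eq_preimage, ← Set.biUnion_preimage_singleton]
  exact MeasurableSet.biUnion (Set.to_countable _) fun z _ => hπ.measurableSet_fiber m z

/-- An inequality between two measures on all the cells making up `E` can be summed. -/
theorem IsCellUnion.measure_le [Countable ι] (hπ : IsNested π) {m : ℕ} {E : Set Ω}
    (hE : IsCellUnion π m E) {μ ν : Measure Ω}
    (h : ∀ x ∈ E, μ (cell π m x) ≤ ν (cell π m x)) : μ E ≤ ν E := by
  rw [hE.eq_preimage,
    ← tsum_measure_preimage_singleton (Set.to_countable _)
      (fun z _ => hπ.measurableSet_fiber m z),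
    ← tsum_measure_preimage_singleton (Set.to_countable _)
      (fun z _ => hπ.measurableSet_fiber m z)]
  refine ENNReal.tsum_le_tsum ?_
  rintro ⟨z, x, hx, rfl⟩
  exact h x hx

/-- The points of the cells of level `m` at which the ratio `ν / μ` exceeds `t` for the first
time. -/
def stopSet (π : ℕ → Ω → ι) (μ ν : Measure Ω) (t : ℝ≥0∞) (m : ℕ) : Set Ω :=
  {x | t * μ (cell π m x) < ν (cell π m x) ∧ ∀ j < m, ν (cell π j x) ≤ t * μ (cell π j x)}

/-- The points lying in some cell on which the ratio `ν / μ` exceeds `t`, that is, the superlevel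
set of the associated maximal function. -/
def maxSet (π : ℕ → Ω → ι) (μ ν : Measure Ω) (t : ℝ≥0∞) : Set Ω :=
  {x | ∃ m, t * μ (cell π m x) < ν (cell π m x)}

theorem mem_maxSet_iff {μ ν : Measure Ω} {t : ℝ≥0∞} {x : Ω} :
    x ∈ maxSet π μ ν t ↔ ∃ m, x ∈ stopSet π μ ν t m := by
  classical
  refine ⟨fun h => ⟨Nat.find h, Nat.find_spec h, fun j hj => not_lt.1 (Nat.find_min h hj)⟩, ?_⟩
  rintro ⟨m, hm, -⟩
  exact ⟨m, hm⟩

theorem maxSet_eq_iUnion (π : ℕ → Ω → ι) (μ ν : Measure Ω) (t : ℝ≥0∞) :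
    maxSet π μ ν t = ⋃ m, stopSet π μ ν t m := by
  ext x
  rw [Set.mem_iUnion, mem_maxSet_iff]

theorem maxSet_anti {μ ν : Measure Ω} {s t : ℝ≥0∞} (h : s ≤ t) :
    maxSet π μ ν t ⊆ maxSet π μ ν s :=
  fun _ ⟨m, hm⟩ => ⟨m, (mul_le_mul_left h _).trans_lt hm⟩

theorem pairwise_disjoint_stopSet (μ ν : Measure Ω) (t : ℝ≥0∞) :
    Pairwise (Function.onFun Disjoint (stopSet π μ ν t)) := by
  refine (pairwise_disjoint_on _).2 fun i j hij => Set.disjoint_left.2 fun x hi hj => ?_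
  exact (hj.2 i hij).not_gt hi.1

theorem IsNested.isCellUnion_stopSet (hπ : IsNested π) (μ ν : Measure Ω) (t : ℝ≥0∞) (m : ℕ) :
    IsCellUnion π m (stopSet π μ ν t m) := by
  intro x hx y hy
  refine ⟨?_, fun j hj => ?_⟩
  · rw [cell_congr (π := π) hy]
    exact hx.1
  · rw [cell_congr (π := π) (hπ.eq_of_le hj.le hy)]
    exact hx.2 j hj

theorem IsNested.measurableSet_maxSet [Countable ι] (hπ : IsNested π) (μ ν : Measure Ω)
    (t : ℝ≥0∞) : MeasurableSet (maxSet π μ ν t) := by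
  rw [maxSet_eq_iUnion]
  exact MeasurableSet.iUnion fun m => (hπ.isCellUnion_stopSet μ ν t m).measurableSet hπ

/-- Chebyshev's inequality for the maximal function, localised to a cell none of whose proper
ancestors has been selected. -/
theorem IsNested.mul_measure_maxSet_inter_cell_le [Countable ι] (hπ : IsNested π)
    {μ ν : Measure Ω} {t : ℝ≥0∞} {m : ℕ} {x : Ω}
    (hx : ∀ j < m, ν (cell π j x) ≤ t * μ (cell π j x)) :
    t * μ (maxSet π μ ν t ∩ cell π m x) ≤ ν (cell π m x) := by
  refine le_trans ?_ (measure_mono (Set.inter_subset_right (s := maxSet π μ ν t)))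
  have hdisj : Pairwise (Function.onFun Disjoint fun j => stopSet π μ ν t j ∩ cell π m x) :=
    fun i j hij => (pairwise_disjoint_stopSet μ ν t hij).mono Set.inter_subset_left
      Set.inter_subset_left
  have hmeas : ∀ j, MeasurableSet (stopSet π μ ν t j ∩ cell π m x) := fun j =>
    ((hπ.isCellUnion_stopSet μ ν t j).measurableSet hπ).inter (hπ.measurableSet_cell m x)
  rw [maxSet_eq_iUnion, Set.iUnion_inter, measure_iUnion hdisj hmeas, measure_iUnion hdisj hmeas,
    ← ENNReal.tsum_mul_left]
  refine ENNReal.tsum_le_tsum fun j => ?_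
  rcases lt_or_ge j m with hj | hj
  · -- a cell of level `j < m` meeting `cell π m x` is an ancestor of it, hence not selected
    have hempty : stopSet π μ ν t j ∩ cell π m x = ∅ := by
      refine Set.eq_empty_of_forall_notMem fun y hy => ?_
      have h1 := hy.1.1
      rw [cell_congr (π := π) (hπ.eq_of_le hj.le hy.2)] at h1
      exact (hx j hj).not_gt h1
    simp [hempty]
  · refine IsCellUnion.measure_le (μ := t • μ) hπ
      ((hπ.isCellUnion_stopSet μ ν t j).inter (hπ.isCellUnion_cell hj x)) fun y hy => ?_
    exact hy.1.1.le

/-- If small `μ`-proportion forces `ν`-proportion at most `β` on every cell, then the `ν`-measure of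
the superlevel set of the maximal function drops by the factor `β` from height `s` to height `t`,
provided that `t / s` is at least the doubling constant over `α`. -/
theorem IsNested.measure_maxSet_le [Countable ι] (hπ : IsNested π) {μ ν : Measure Ω}
    {α β D s t : ℝ≥0∞} (hα : α ≤ 1) (hD : 1 ≤ D) {x₀ : Ω}
    (hdoub : ∀ m, ∀ x ∈ cell π 0 x₀, μ (cell π m x) ≤ D * μ (cell π (m + 1) x))
    (hsmall : ∀ m, ∀ x ∈ cell π 0 x₀, ∀ A ⊆ cell π m x, MeasurableSet A →
      μ A ≤ α * μ (cell π m x) → ν A ≤ β * ν (cell π m x))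
    (hs : ν (cell π 0 x₀) ≤ s * μ (cell π 0 x₀)) (ht : t ≠ 0) (ht' : t ≠ ⊤)
    (hst : D * s ≤ α * t) :
    ν (maxSet π μ ν t ∩ cell π 0 x₀) ≤ β * ν (maxSet π μ ν s ∩ cell π 0 x₀) := by
  have hle : s ≤ t :=
    calc s ≤ D * s := le_mul_of_one_le_left' hD
      _ ≤ α * t := hst
      _ ≤ t := mul_le_of_le_one_left' hα
  have hdisj : Pairwise (Function.onFun Disjoint fun j => stopSet π μ ν s j ∩ cell π 0 x₀) :=
    fun i j hij => (pairwise_disjoint_stopSet μ ν s hij).mono Set.inter_subset_left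
      Set.inter_subset_left
  have hcu : ∀ m, IsCellUnion π m (stopSet π μ ν s m ∩ cell π 0 x₀) := fun m =>
    (hπ.isCellUnion_stopSet μ ν s m).inter (hπ.isCellUnion_cell (Nat.zero_le m) x₀)
  have hT := hπ.measurableSet_maxSet μ ν t
  have key : ∀ m, ν (maxSet π μ ν t ∩ (stopSet π μ ν s m ∩ cell π 0 x₀)) ≤
      β * ν (stopSet π μ ν s m ∩ cell π 0 x₀) := by
    intro m
    have := (hcu m).measure_le hπ (μ := ν.restrict (maxSet π μ ν t)) (ν := β • ν) fun x hx => ?_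
    · rwa [Measure.restrict_apply ((hcu m).measurableSet hπ), Set.inter_comm] at this
    rw [Measure.restrict_apply (hπ.measurableSet_cell m x), Set.inter_comm]
    refine hsmall m x hx.2 _ Set.inter_subset_right (hT.inter (hπ.measurableSet_cell m x)) ?_
    have hcheb := hπ.mul_measure_maxSet_inter_cell_le (t := t) (μ := μ) (ν := ν) (m := m) (x := x)
      fun j hj => (hx.1.2 j hj).trans (mul_le_mul_left hle _)
    have hup : ν (cell π m x) ≤ D * s * μ (cell π m x) := by
      rcases m with _ | m
      · rw [cell_congr (π := π) hx.2]
        exact hs.trans (mul_le_mul_left (le_mul_of_one_le_left' hD) _)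
      · calc ν (cell π (m + 1) x) ≤ ν (cell π m x) :=
              measure_mono (hπ.cell_subset (Nat.le_succ m) x)
          _ ≤ s * μ (cell π m x) := hx.1.2 m (Nat.lt_succ_self m)
          _ ≤ s * (D * μ (cell π (m + 1) x)) := mul_le_mul_right (hdoub m x hx.2) _
          _ = _ := by ring
    refine (ENNReal.mul_le_mul_iff_right ht ht').1 ?_
    calc t * μ (maxSet π μ ν t ∩ cell π m x) ≤ D * s * μ (cell π m x) := hcheb.trans hup
      _ ≤ α * t * μ (cell π m x) := mul_le_mul_left hst _
      _ = t * (α * μ (cell π m x)) := by ring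
  have hsub : maxSet π μ ν t ∩ cell π 0 x₀ =
      ⋃ m, maxSet π μ ν t ∩ (stopSet π μ ν s m ∩ cell π 0 x₀) := by
    rw [← Set.inter_iUnion, ← Set.iUnion_inter, ← maxSet_eq_iUnion, ← Set.inter_assoc,
      Set.inter_eq_left.2 (maxSet_anti hle)]
  rw [hsub, maxSet_eq_iUnion π μ ν s, Set.iUnion_inter,
    measure_iUnion hdisj fun m => (hcu m).measurableSet hπ, ← ENNReal.tsum_mul_left]
  exact (measure_iUnion_le _).trans (ENNReal.tsum_le_tsum key)

theorem exists_rpow_mul_lt_one {L β : ℝ≥0∞} (hL : L ≠ 0) (hL' : L ≠ ⊤) (hβ : β < 1) :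
    ∃ ε : ℝ, 0 < ε ∧ L ^ ε * β < 1 := by
  have hcont : Tendsto (fun ε : ℝ => L ^ ε * β) (𝓝[>] 0) (𝓝 (L ^ (0 : ℝ) * β)) := by
    refine ENNReal.Tendsto.mul_const ?_ (Or.inr hβ.ne_top)
    lift L to NNReal using hL'
    have hL0 : L ≠ 0 := by simpa using hL
    have h : Tendsto (fun ε : ℝ => L ^ ε) (𝓝[>] 0) (𝓝 (L ^ (0 : ℝ))) := by
      refine NNReal.tendsto_coe.1 ?_
      simp only [NNReal.coe_rpow]
      exact ((Real.continuous_const_rpow (NNReal.coe_ne_zero.2 hL0)).tendsto 0).mono_left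
        nhdsWithin_le_nhds
    have h := ENNReal.tendsto_coe.2 h
    simpa only [ENNReal.coe_rpow_of_ne_zero hL0] using h
  rw [ENNReal.rpow_zero, one_mul] at hcont
  obtain ⟨ε, hε, hε0⟩ := ((hcont.eventually_lt_const hβ).and self_mem_nhdsWithin).exists
  exact ⟨ε, hε0, hε⟩

/-- The reverse Hölder inequality, for two measures on a nested sequence of partitions: if `μ` is
doubling and small `μ`-proportion forces `ν`-proportion at most `β < 1` on every cell, then a power
of a function `f` dominated by the maximal function (in practice, the density `dν / dμ`) is
integrable. The exponent and the constant depend only on `α`, `β` and the doubling constant. -/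
theorem IsNested.exists_lintegral_rpow_le [Countable ι] {α β D : ℝ≥0∞} (hα0 : α ≠ 0) (hα : α ≤ 1)
    (hβ : β < 1) (hD : 1 ≤ D) (hD' : D ≠ ⊤) :
    ∃ ε : ℝ, 0 < ε ∧ ∃ K : ℝ≥0∞, K ≠ ⊤ ∧
      ∀ {π : ℕ → Ω → ι} (_ : IsNested π) {μ ν : Measure Ω} {x₀ : Ω} {f : Ω → ℝ≥0∞},
        (∀ m, ∀ x ∈ cell π 0 x₀, μ (cell π m x) ≤ D * μ (cell π (m + 1) x)) →
        (∀ m, ∀ x ∈ cell π 0 x₀, ∀ A ⊆ cell π m x, MeasurableSet A →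
          μ A ≤ α * μ (cell π m x) → ν A ≤ β * ν (cell π m x)) →
        μ (cell π 0 x₀) ≠ 0 → μ (cell π 0 x₀) ≠ ⊤ → ν (cell π 0 x₀) ≠ 0 → ν (cell π 0 x₀) ≠ ⊤ →
        (∀ᵐ x ∂ν.restrict (cell π 0 x₀), ∀ t : ℝ≥0∞,
          (∀ m, ν (cell π m x) ≤ t * μ (cell π m x)) → f x ≤ t) →
        ∫⁻ x in cell π 0 x₀, f x ^ ε ∂ν ≤
          K * (ν (cell π 0 x₀) / μ (cell π 0 x₀)) ^ ε * ν (cell π 0 x₀) := by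
  set L : ℝ≥0∞ := D / α + 2 with hLdef
  have hL' : L ≠ ⊤ := by simp [hLdef, ENNReal.div_eq_top, hα0, hD']
  have hL2 : 2 ≤ L := le_add_self
  have hL0 : L ≠ 0 := fun h => by simp [h] at hL2
  have hDL : D ≤ α * L := by
    rw [hLdef, mul_add, ENNReal.mul_div_cancel hα0 (ne_top_of_le_ne_top one_ne_top hα)]
    exact le_self_add
  obtain ⟨ε, hε, hr⟩ := exists_rpow_mul_lt_one hL0 hL' hβ
  refine ⟨ε, hε, 1 + L ^ ε * (1 - L ^ ε * β)⁻¹, ?_, ?_⟩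
  · refine add_ne_top.2 ⟨one_ne_top, mul_ne_top (rpow_ne_top_of_nonneg hε.le hL') ?_⟩
    exact inv_ne_top.2 (tsub_pos_of_lt hr).ne'
  intro π hπ μ ν x₀ f hdoub hsmall hμ0 hμ hν0 hν hf
  set Q := cell π 0 x₀ with hQ
  set a := ν Q / μ Q with ha
  have ha0 : a ≠ 0 := (ENNReal.div_pos hν0 hμ).ne'
  have hat : a ≠ ⊤ := ENNReal.div_ne_top hν hμ0
  -- the heights increase by the factor `L`, starting from the average on the top cell
  let t : ℕ → ℝ≥0∞ := fun k => L ^ k * a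
  have ht0 : ∀ k, t k ≠ 0 := fun k => mul_ne_zero (pow_ne_zero _ hL0) ha0
  have htt : ∀ k, t k ≠ ⊤ := fun k => mul_ne_top (pow_ne_top hL') hat
  have hat_le : ∀ k, a ≤ t k := fun k =>
    le_mul_of_one_le_left' (one_le_pow_of_one_le' (one_le_two.trans hL2) k)
  have hdecay : ∀ k, ν (maxSet π μ ν (t k) ∩ Q) ≤ β ^ k * ν Q := by
    intro k
    induction k with
    | zero => simpa using measure_mono Set.inter_subset_right
    | succ k ih =>
      refine (hπ.measure_maxSet_le (s := t k) hα hD hdoub hsmall ?_ (ht0 _) (htt _) ?_).trans ?_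
      · calc ν Q = a * μ Q := (ENNReal.div_mul_cancel hμ0 hμ).symm
          _ ≤ t k * μ Q := mul_le_mul_left (hat_le k) _
      · calc D * t k ≤ α * L * t k := mul_le_mul_left hDL _
          _ = α * t (k + 1) := by simp only [t]; ring
      · calc β * ν (maxSet π μ ν (t k) ∩ Q) ≤ β * (β ^ k * ν Q) := mul_le_mul_right ih _
          _ = β ^ (k + 1) * ν Q := by ring
  have hmeas : ∀ k, MeasurableSet (maxSet π μ ν (t k)) := fun k => hπ.measurableSet_maxSet μ ν _
  have hpt : ∀ᵐ x ∂ν.restrict Q, f x ^ ε ≤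
      a ^ ε + ∑' k, (maxSet π μ ν (t k)).indicator (fun _ => t (k + 1) ^ ε) x := by
    filter_upwards [hf] with x hx
    have hout : ∀ k, x ∉ maxSet π μ ν (t k) → f x ≤ t k := fun k hk =>
      hx _ fun m => not_lt.1 fun h => hk ⟨m, h⟩
    by_cases h0 : ∃ k, x ∉ maxSet π μ ν (t k)
    · classical
      have hspec := Nat.find_spec h0
      rcases hk : Nat.find h0 with _ | k
      · rw [hk] at hspec
        have := hout 0 hspec
        refine le_add_of_le_of_nonneg (ENNReal.rpow_le_rpow ?_ hε.le) (zero_le)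
        simpa [t] using this
      · have hin : x ∈ maxSet π μ ν (t k) := not_not.1 (Nat.find_min h0 (m := k) (by omega))
        rw [hk] at hspec
        refine le_trans ?_ (le_add_self.trans (add_le_add_right (ENNReal.le_tsum k) _))
        rw [Set.indicator_of_mem hin]
        exact ENNReal.rpow_le_rpow (hout _ hspec) hε.le
    · -- where the maximal function is infinite, so is the right-hand side
      push Not at h0
      have htop : ∑' k, (maxSet π μ ν (t k)).indicator (fun _ => t (k + 1) ^ ε) x = ⊤ := by
        refine top_unique ?_
        calc (⊤ : ℝ≥0∞) = ∑' _ : ℕ, a ^ ε :=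
              (ENNReal.tsum_const_eq_top_of_ne_zero
                (by simp [ENNReal.rpow_eq_zero_iff, ha0, hat])).symm
          _ ≤ _ := by
            refine ENNReal.tsum_le_tsum fun k => ?_
            rw [Set.indicator_of_mem (h0 k)]
            exact ENNReal.rpow_le_rpow (hat_le _) hε.le
      simp [htop]
  calc ∫⁻ x in Q, f x ^ ε ∂ν
      ≤ ∫⁻ x in Q, (a ^ ε + ∑' k, (maxSet π μ ν (t k)).indicator (fun _ => t (k + 1) ^ ε) x) ∂ν :=
        lintegral_mono_ae hpt
    _ = a ^ ε * ν Q + ∑' k, t (k + 1) ^ ε * ν (maxSet π μ ν (t k) ∩ Q) := by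
        rw [lintegral_add_left measurable_const, lintegral_tsum fun k =>
          (measurable_const.indicator (hmeas k)).aemeasurable]
        simp [lintegral_indicator (hmeas _), Measure.restrict_apply (hmeas _)]
    _ ≤ a ^ ε * ν Q + ∑' k, L ^ ε * a ^ ε * ν Q * (L ^ ε * β) ^ k := by
        refine add_le_add_right (ENNReal.tsum_le_tsum fun k => ?_) _
        refine (mul_le_mul_right (hdecay k) _).trans (le_of_eq ?_)
        simp only [t]
        rw [ENNReal.mul_rpow_of_nonneg _ _ hε.le, ← ENNReal.rpow_natCast, ← ENNReal.rpow_mul,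
          mul_comm _ ε, ENNReal.rpow_mul, ENNReal.rpow_natCast]
        ring
    _ = (1 + L ^ ε * (1 - L ^ ε * β)⁻¹) * a ^ ε * ν Q := by
        rw [ENNReal.tsum_mul_left, ENNReal.tsum_geometric]
        ring

end Nested

variable {n : ℕ}

/-! ### Cubes -/

theorem cube_eq_pi (c : Fin n → ℝ) (l : ℝ) :
    cube c l = Set.univ.pi fun i => Set.Ioo (c i - l / 2) (c i + l / 2) := by
  ext x
  simp only [cube, Set.mem_ofPred_eq, Set.mem_univ_pi, Set.mem_Ioo, abs_lt]
  exact forall_congr' fun i => ⟨fun h => ⟨by linarith, by linarith⟩,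
    fun h => ⟨by linarith, by linarith⟩⟩

theorem measurableSet_cube (c : Fin n → ℝ) (l : ℝ) : MeasurableSet (cube c l) := by
  rw [cube_eq_pi]
  exact MeasurableSet.univ_pi fun i => measurableSet_Ioo

theorem volume_cube (c : Fin n → ℝ) (l : ℝ) : volume (cube c l) = ENNReal.ofReal l ^ n := by
  rw [cube_eq_pi, Real.volume_pi_Ioo]
  simp

theorem volume_cube_ne_zero (c : Fin n → ℝ) {l : ℝ} (hl : 0 < l) : volume (cube c l) ≠ 0 := by
  rw [volume_cube]
  exact pow_ne_zero _ (ENNReal.ofReal_pos.2 hl).ne'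

theorem volume_cube_ne_top (c : Fin n → ℝ) (l : ℝ) : volume (cube c l) ≠ ⊤ := by
  rw [volume_cube]
  exact pow_ne_top ofReal_ne_top

theorem cube_ae_eq_closedBall (c : Fin n → ℝ) {l : ℝ} (hl : 0 < l) :
    cube c l =ᵐ[volume] Metric.closedBall c (l / 2) := by
  rw [cube_eq_pi, closedBall_pi _ (half_pos hl).le]
  simp only [Real.closedBall_eq_Icc]
  exact Measure.pi_Ioo_ae_eq_pi_Icc

/-! ### Dyadic subcubes -/

/-- The label of the half-open dyadic subcube of level `m` containing `x`, in the grid generated by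
the cube with center `c` and side length `l`. -/
noncomputable def dyadicIndex (c : Fin n → ℝ) (l : ℝ) (m : ℕ) (x : Fin n → ℝ) : Fin n → ℤ :=
  fun i => ⌊(x i - (c i - l / 2)) / (l / 2 ^ m)⌋

/-- The center of the dyadic subcube of level `m` containing `x`. -/
noncomputable def dyadicCenter (c : Fin n → ℝ) (l : ℝ) (m : ℕ) (x : Fin n → ℝ) : Fin n → ℝ :=
  fun i => c i - l / 2 + (dyadicIndex c l m x i + 1 / 2) * (l / 2 ^ m)

theorem side_pos {l : ℝ} (hl : 0 < l) (m : ℕ) : 0 < l / 2 ^ m := by positivity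

theorem side_le {l : ℝ} (hl : 0 < l) (m : ℕ) : l / 2 ^ m ≤ l :=
  div_le_self hl.le (one_le_pow₀ one_le_two)

theorem cell_dyadicIndex_eq_pi (c : Fin n → ℝ) {l : ℝ} (hl : 0 < l) (m : ℕ) (x : Fin n → ℝ) :
    cell (dyadicIndex c l) m x = Set.univ.pi fun i =>
      Set.Ico (dyadicCenter c l m x i - l / 2 ^ m / 2)
        (dyadicCenter c l m x i + l / 2 ^ m / 2) := by
  have h := side_pos hl m
  ext y
  simp only [cell, Set.mem_ofPred_eq, Set.mem_univ_pi, Set.mem_Ico]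
  rw [funext_iff]
  refine forall_congr' fun i => ?_
  conv_lhs => lhs; rw [dyadicIndex]
  rw [Int.floor_eq_iff, le_div_iff₀ h, div_lt_iff₀ h, dyadicCenter]
  exact ⟨fun h => ⟨by linarith, by linarith⟩, fun h => ⟨by linarith, by linarith⟩⟩

theorem cell_dyadicIndex_ae_eq_cube (c : Fin n → ℝ) {l : ℝ} (hl : 0 < l) (m : ℕ)
    (x : Fin n → ℝ) :
    cell (dyadicIndex c l) m x =ᵐ[volume] cube (dyadicCenter c l m x) (l / 2 ^ m) := by
  rw [cell_dyadicIndex_eq_pi c hl, cube_eq_pi]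
  exact Measure.pi_Ico_ae_eq_pi_Icc.trans Measure.pi_Ioo_ae_eq_pi_Icc.symm

theorem dyadicCenter_zero (c : Fin n → ℝ) {l : ℝ} (hl : 0 < l) : dyadicCenter c l 0 c = c := by
  have h : ∀ i, dyadicIndex c l 0 c i = 0 := fun i => by
    have h1 : (c i - (c i - l / 2)) / (l / 2 ^ 0) = 1 / 2 := by
      field_simp
      ring
    rw [dyadicIndex, h1]
    norm_num
  ext i
  rw [dyadicCenter, h]
  norm_num
  ring

theorem dyadicIndex_succ (c : Fin n → ℝ) {l : ℝ} (hl : 0 < l) (m : ℕ) (x : Fin n → ℝ)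
    (i : Fin n) :
    dyadicIndex c l (m + 1) x i = 2 * dyadicIndex c l m x i ∨
      dyadicIndex c l (m + 1) x i = 2 * dyadicIndex c l m x i + 1 := by
  simp only [dyadicIndex]
  set u := (x i - (c i - l / 2)) / (l / 2 ^ m) with hu
  have h1 : (x i - (c i - l / 2)) / (l / 2 ^ (m + 1)) = 2 * u := by
    rw [hu, pow_succ]
    field_simp
  rw [h1]
  have h2 : 2 * ⌊u⌋ ≤ ⌊2 * u⌋ := by
    rw [Int.le_floor]
    push_cast
    linarith [Int.floor_le u]
  have h3 : ⌊2 * u⌋ < 2 * ⌊u⌋ + 2 := by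
    rw [Int.floor_lt]
    push_cast
    linarith [Int.lt_floor_add_one u]
  omega

theorem isNested_dyadicIndex (c : Fin n → ℝ) {l : ℝ} (hl : 0 < l) :
    IsNested (dyadicIndex c l) where
  measurableSet_fiber m z := by
    have : Measurable (dyadicIndex c l m) := by
      refine measurable_pi_lambda _ fun i => Int.measurable_floor.comp ?_
      exact ((measurable_pi_apply i).sub_const _).div_const _
    exact this (measurableSet_singleton z)
  succ m x y h := by
    ext i
    have hx := dyadicIndex_succ c hl m x i
    have hy := dyadicIndex_succ c hl m y i
    have := congrFun h i
    omega

theorem abs_dyadicCenter_succ_sub_le (c : Fin n → ℝ) {l : ℝ} (hl : 0 < l) (m : ℕ)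
    (x : Fin n → ℝ) (i : Fin n) :
    |dyadicCenter c l (m + 1) x i - dyadicCenter c l m x i| ≤ l / 2 ^ m / 4 := by
  have h := side_pos hl m
  have h2 : l / 2 ^ (m + 1) = l / 2 ^ m / 2 := by rw [pow_succ, div_mul_eq_div_div]
  simp only [dyadicCenter, h2]
  rw [abs_le]
  rcases dyadicIndex_succ c hl m x i with hi | hi <;> rw [hi] <;> push_cast <;>
    constructor <;> nlinarith

theorem volume_cell_dyadicIndex (c : Fin n → ℝ) {l : ℝ} (hl : 0 < l) (m : ℕ) (x : Fin n → ℝ) :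
    volume (cell (dyadicIndex c l) m x) = ENNReal.ofReal (l / 2 ^ m) ^ n := by
  rw [measure_congr (cell_dyadicIndex_ae_eq_cube c hl m x), volume_cube]

theorem ofReal_side {l : ℝ} (m : ℕ) :
    ENNReal.ofReal l = 2 ^ m * ENNReal.ofReal (l / 2 ^ m) := by
  have h : (2 : ℝ≥0∞) ^ m = ENNReal.ofReal (2 ^ m) := by
    rw [ENNReal.ofReal_pow zero_le_two, ENNReal.ofReal_ofNat]
  rw [h, ← ENNReal.ofReal_mul (by positivity), mul_div_cancel₀ _ (by positivity)]

/-! ### The measure with density a weight -/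

/-- The measure with density `ω`. -/
noncomputable def wtMeasure (ω : (Fin n → ℝ) → ℝ) : Measure (Fin n → ℝ) :=
  volume.withDensity fun x => ENNReal.ofReal (ω x)

theorem wtMeasure_apply (ω : (Fin n → ℝ) → ℝ) (E : Set (Fin n → ℝ)) : wtMeasure ω E = wt ω E :=
  withDensity_apply' _ _

theorem wtMeasure_absolutelyContinuous (ω : (Fin n → ℝ) → ℝ) : wtMeasure ω ≪ volume :=
  withDensity_absolutelyContinuous _ _

theorem wt_congr {ω : (Fin n → ℝ) → ℝ} {E F : Set (Fin n → ℝ)} (h : E =ᵐ[volume] F) :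
    wt ω E = wt ω F := by
  rw [← wtMeasure_apply, ← wtMeasure_apply]
  exact measure_congr ((wtMeasure_absolutelyContinuous ω).ae_eq h)

theorem avg_congr {ω : (Fin n → ℝ) → ℝ} {E F : Set (Fin n → ℝ)} (h : E =ᵐ[volume] F) :
    avg ω E = avg ω F := by
  rw [avg, avg, wt_congr h, measure_congr h]

theorem wt_mono {ω : (Fin n → ℝ) → ℝ} {E F : Set (Fin n → ℝ)} (h : E ⊆ F) :
    wt ω E ≤ wt ω F :=
  lintegral_mono_set h

namespace IsWeight

variable {ω : (Fin n → ℝ) → ℝ}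

theorem aemeasurable (hω : IsWeight ω) : AEMeasurable ω volume :=
  hω.locallyIntegrable.aestronglyMeasurable.aemeasurable

theorem integrableOn_cube (hω : IsWeight ω) (c : Fin n → ℝ) {l : ℝ} (hl : 0 < l) :
    IntegrableOn ω (cube c l) volume := by
  rw [cube_eq_ball c hl]
  exact (hω.locallyIntegrable.integrableOn_isCompact
    (isCompact_closedBall c (l / 2))).mono_set Metric.ball_subset_closedBall

theorem wt_cube_ne_top (hω : IsWeight ω) (c : Fin n → ℝ) {l : ℝ} (hl : 0 < l) :
    wt ω (cube c l) ≠ ⊤ :=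
  (hω.integrableOn_cube c hl).lintegral_lt_top.ne

theorem wt_ne_zero (hω : IsWeight ω) {E : Set (Fin n → ℝ)} (hE : volume E ≠ 0) :
    wt ω E ≠ 0 := by
  rw [wt, Ne, lintegral_eq_zero_iff' (hω.aemeasurable.restrict.ennreal_ofReal)]
  intro h
  refine hE (Measure.restrict_eq_zero.1 (ae_eq_bot.1 (eventually_false_iff_eq_bot.1 ?_)))
  filter_upwards [h, ae_restrict_of_ae hω.ae_pos] with x hx hx'
  exact (ENNReal.ofReal_pos.2 hx').ne' hx

theorem wt_cube_ne_zero (hω : IsWeight ω) (c : Fin n → ℝ) {l : ℝ} (hl : 0 < l) :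
    wt ω (cube c l) ≠ 0 :=
  hω.wt_ne_zero (volume_cube_ne_zero c hl)

theorem avg_cube_ne_zero (hω : IsWeight ω) (c : Fin n → ℝ) {l : ℝ} (hl : 0 < l) :
    avg ω (cube c l) ≠ 0 :=
  (ENNReal.div_pos (hω.wt_cube_ne_zero c hl) (volume_cube_ne_top c l)).ne'

theorem avg_cube_ne_top (hω : IsWeight ω) (c : Fin n → ℝ) {l : ℝ} (hl : 0 < l) :
    avg ω (cube c l) ≠ ⊤ :=
  ENNReal.div_ne_top (hω.wt_cube_ne_top c hl) (volume_cube_ne_zero c hl)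

theorem avg_cube_eq_ofReal (hω : IsWeight ω) (c : Fin n → ℝ) {l : ℝ} (hl : 0 < l) :
    avg ω (cube c l) = ENNReal.ofReal (⨍ y in cube c l, ω y) := by
  rw [avg, wt, setAverage_eq, smul_eq_mul, mul_comm, ← div_eq_mul_inv,
    measureReal_def, ENNReal.ofReal_div_of_pos
      (ENNReal.toReal_pos (volume_cube_ne_zero c hl) (volume_cube_ne_top c l)),
    ofReal_integral_eq_lintegral_ofReal (hω.integrableOn_cube c hl)
      (Eventually.of_forall hω.nonneg), ENNReal.ofReal_toReal (volume_cube_ne_top c l)]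

/-- Lebesgue's differentiation theorem along dyadic subcubes. The point need not be the center of
the cubes, which are balls of the supremum norm. -/
theorem ae_tendsto_avg_cell (hω : IsWeight ω) (c : Fin n → ℝ) {l : ℝ} (hl : 0 < l) :
    ∀ᵐ x, Tendsto (fun m => avg ω (cell (dyadicIndex c l) m x)) atTop
      (𝓝 (ENNReal.ofReal (ω x))) := by
  filter_upwards [IsUnifLocDoublingMeasure.ae_tendsto_average volume hω.locallyIntegrable 1]
    with x hx
  have hside : Tendsto (fun m : ℕ => l / 2 ^ m / 2) atTop (𝓝[>] 0) := by
    refine tendsto_nhdsWithin_iff.2 ⟨?_, Eventually.of_forall fun m =>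
      half_pos (side_pos hl m)⟩
    have h := (tendsto_pow_atTop_nhds_zero_of_lt_one (r := (1 / 2 : ℝ)) (by norm_num)
      (by norm_num)).const_mul (l / 2)
    rw [mul_zero] at h
    refine h.congr fun m => ?_
    rw [one_div, inv_pow]
    ring
  have := hx (dyadicCenter c l · x) _ hside (Eventually.of_forall fun m => by
    rw [one_mul, closedBall_pi _ (half_pos (side_pos hl m)).le, Set.mem_univ_pi]
    have hm := mem_cell_self (dyadicIndex c l) m x
    rw [cell_dyadicIndex_eq_pi c hl, Set.mem_univ_pi] at hm
    intro i
    rw [Real.closedBall_eq_Icc]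
    exact Set.Ico_subset_Icc_self (hm i))
  refine (ENNReal.tendsto_ofReal this).congr fun m => ?_
  rw [avg_congr (cell_dyadicIndex_ae_eq_cube c hl m x), hω.avg_cube_eq_ofReal _ (side_pos hl m),
    setAverage_congr (cube_ae_eq_closedBall _ (side_pos hl m))]

end IsWeight

variable {ω : (Fin n → ℝ) → ℝ} {ρ : ℝ}

/-! ### The conditions -/

/-- On every cube of side at most `ρ`, the set where `ω` is at most `γ` times its average fills at
most the proportion `δ`, for some fixed `γ, δ < 1`. -/
def HasSmallSublevels (ρ : ℝ) (ω : (Fin n → ℝ) → ℝ) : Prop :=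
  ∃ γ δ : ℝ, 0 < γ ∧ γ < 1 ∧ 0 < δ ∧ δ < 1 ∧
    ∀ Q : Set (Fin n → ℝ), IsCubeUpTo ρ Q →
      volume {x ∈ Q | ENNReal.ofReal (ω x) ≤ ENNReal.ofReal γ * avg ω Q} ≤
        ENNReal.ofReal δ * volume Q

/-- Small Lebesgue proportion forces weighted proportion bounded away from `1`. -/
def SmallVolumeBoundsWeight (ρ : ℝ) (ω : (Fin n → ℝ) → ℝ) : Prop :=
  ∃ α β : ℝ, 0 < α ∧ α < 1 ∧ 0 < β ∧ β < 1 ∧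
    ∀ Q : Set (Fin n → ℝ), IsCubeUpTo ρ Q →
      ∀ A : Set (Fin n → ℝ), A ⊆ Q → NullMeasurableSet A volume →
        volume A ≤ ENNReal.ofReal α * volume Q → wt ω A ≤ ENNReal.ofReal β * wt ω Q

/-- The reverse Hölder inequality on cubes of side at most `ρ`, for some exponent above `1`. -/
def HasReverseHolder (ρ : ℝ) (ω : (Fin n → ℝ) → ℝ) : Prop :=
  ∃ C₁ ε : ℝ, 0 < C₁ ∧ 0 < ε ∧
    ∀ Q : Set (Fin n → ℝ), IsCubeUpTo ρ Q →
      ((∫⁻ x in Q, ENNReal.ofReal (ω x) ^ (1 + ε)) / volume Q) ^ (1 / (1 + ε)) ≤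
        ENNReal.ofReal C₁ * avg ω Q

/-- The weighted proportion is controlled by a power of the Lebesgue proportion. -/
def HasPowerBound (ρ : ℝ) (ω : (Fin n → ℝ) → ℝ) : Prop :=
  ∃ C₂ ε₀ : ℝ, 0 < C₂ ∧ 0 < ε₀ ∧
    ∀ Q : Set (Fin n → ℝ), IsCubeUpTo ρ Q →
      ∀ A : Set (Fin n → ℝ), A ⊆ Q → NullMeasurableSet A volume →
        wt ω A / wt ω Q ≤ ENNReal.ofReal C₂ * (volume A / volume Q) ^ ε₀

/-- Small weighted proportion forces Lebesgue proportion bounded away from `1`. -/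
def SmallWeightBoundsVolume (ρ : ℝ) (ω : (Fin n → ℝ) → ℝ) : Prop :=
  ∃ α' β' : ℝ, 0 < α' ∧ α' < 1 ∧ 0 < β' ∧ β' < 1 ∧
    ∀ Q : Set (Fin n → ℝ), IsCubeUpTo ρ Q →
      ∀ A : Set (Fin n → ℝ), A ⊆ Q → NullMeasurableSet A volume →
        wt ω A < ENNReal.ofReal α' * wt ω Q → volume A < ENNReal.ofReal β' * volume Q

theorem wt_add_wt_diff {A Q : Set (Fin n → ℝ)} (hA : NullMeasurableSet A volume) (hAQ : A ⊆ Q) :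
    wt ω A + wt ω (Q \ A) = wt ω Q := by
  simp only [← wtMeasure_apply]
  have h := measure_inter_add_sdiff₀ (μ := wtMeasure ω) Q
    (hA.mono_ac (wtMeasure_absolutelyContinuous ω))
  rwa [Set.inter_eq_self_of_subset_right hAQ] at h

theorem avg_mul_volume_cube (ω : (Fin n → ℝ) → ℝ) (c : Fin n → ℝ) {l : ℝ} (hl : 0 < l) :
    avg ω (cube c l) * volume (cube c l) = wt ω (cube c l) :=
  ENNReal.div_mul_cancel (volume_cube_ne_zero c hl) (volume_cube_ne_top c l)

/-! ### From the logarithmic condition to sublevel sets -/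

/-- With `u = ω / Avg ω`, the function `u - 1 - log u` is nonnegative, its average is bounded by the
logarithm of the `A_∞` constant, and it is large where `u` is small; so Chebyshev's inequality
applies. -/
theorem HasSmallSublevels.of_mem_aInfty (h : ω ∈ AInftyLocAt n ρ) : HasSmallSublevels ρ ω := by
  obtain ⟨hω, hC⟩ := h
  set C := aInftyConst ρ ω with hCdef
  set K := max (Real.log C.toReal) 1 with hK
  have hK1 : 1 ≤ K := le_max_right _ _
  -- where `u ≤ γ = exp (-(2 * K + 1))`, the function `u - 1 - log u` is at least `2 * K`
  refine ⟨Real.exp (-(2 * K + 1)), 1 / 2, Real.exp_pos _, Real.exp_lt_one_iff.2 (by linarith),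
    by norm_num, by norm_num, ?_⟩
  intro Q hQ
  have hle : avg ω Q * expAvgLogInv ω Q ≤ C := by
    rw [hCdef, aInftyConst]
    exact le_iSup₂ (f := fun (Q : Set (Fin n → ℝ)) (_ : IsCubeUpTo ρ Q) =>
      avg ω Q * expAvgLogInv ω Q) Q hQ
  obtain ⟨c, l, hl, -, rfl⟩ := hQ
  set Q := cube c l with hQdef
  have hQ0 := volume_cube_ne_zero c hl
  have hQt := volume_cube_ne_top c l
  set V := volume.real Q with hV
  have hVpos : 0 < V := ENNReal.toReal_pos hQ0 hQt
  set a := ⨍ y in Q, ω y with ha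
  have havg : avg ω Q = ENNReal.ofReal a := hω.avg_cube_eq_ofReal c hl
  have hapos : 0 < a := by
    have := hω.avg_cube_ne_zero c hl
    rw [← hQdef, havg] at this
    exact ENNReal.ofReal_pos.1 (pos_iff_ne_zero.2 this)
  have hint : IntegrableOn (fun x => Real.log (ω x)⁻¹) Q volume := by
    by_contra hn
    rw [expAvgLogInv, if_neg hn, ENNReal.mul_top (hω.avg_cube_ne_zero c hl)] at hle
    exact hC.not_ge hle
  set I := ∫ x in Q, Real.log (ω x)⁻¹ with hI
  have hmean : Real.log a + V⁻¹ * I ≤ K := by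
    rw [expAvgLogInv, if_pos hint, havg, ← ENNReal.ofReal_mul hapos.le,
      ENNReal.ofReal_le_iff_le_toReal hC.ne] at hle
    refine le_trans ?_ (le_max_left _ _)
    rw [← Real.log_exp (V⁻¹ * I), ← Real.log_mul hapos.ne' (Real.exp_pos _).ne']
    exact Real.log_le_log (by positivity) hle
  set g : (Fin n → ℝ) → ℝ := fun x => Real.log (ω x)⁻¹ + (Real.log a - 1) + ω x / a with hg
  have hg1 : IntegrableOn (fun x => Real.log (ω x)⁻¹ + (Real.log a - 1)) Q volume :=
    hint.add (integrableOn_const hQt)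
  have hg2 : IntegrableOn (fun x => ω x / a) Q volume := (hω.integrableOn_cube c hl).div_const a
  have hgint : IntegrableOn g Q volume := hg1.add hg2
  have hωint : ∫ x in Q, ω x = V * a := by
    rw [ha, setAverage_eq, smul_eq_mul, mul_inv_cancel_left₀ hVpos.ne']
  have hgI : ∫ x in Q, g x = V * (Real.log a + V⁻¹ * I) := by
    rw [hg, integral_add hg1 hg2, integral_add hint (integrableOn_const hQt), integral_div, hωint,
      setIntegral_const, smul_eq_mul, ← hI, ← hV]
    field_simp
    ring
  have hpos : ∀ᵐ x ∂volume.restrict Q, 0 < ω x := ae_restrict_of_ae hω.ae_pos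
  have hg0 : 0 ≤ᵐ[volume.restrict Q] g := by
    filter_upwards [hpos] with x hx
    have h1 := Real.log_le_sub_one_of_pos (div_pos hx hapos)
    rw [Real.log_div hx.ne' hapos.ne'] at h1
    simp only [hg, Real.log_inv, Pi.zero_apply]
    linarith
  have hcheb := mul_meas_ge_le_integral_of_nonneg hg0 hgint (2 * K)
  have hreal : (volume.restrict Q).real {x | 2 * K ≤ g x} ≤ 1 / 2 * V := by
    have h1 : ∫ x in Q, g x ≤ V * K := by
      rw [hgI]
      exact mul_le_mul_of_nonneg_left hmean hVpos.le
    have h2 := hcheb.trans h1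
    have h3 : K * (2 * (volume.restrict Q).real {x | 2 * K ≤ g x}) ≤ K * V := by linarith
    have := le_of_mul_le_mul_left h3 (by linarith)
    linarith
  have hfin : (volume.restrict Q) {x | 2 * K ≤ g x} ≠ ⊤ :=
    ne_top_of_le_ne_top hQt ((measure_mono (Set.subset_univ _)).trans
      (Measure.restrict_apply_univ Q).le)
  calc volume {x ∈ Q | ENNReal.ofReal (ω x) ≤ ENNReal.ofReal (Real.exp (-(2 * K + 1))) * avg ω Q}
      = (volume.restrict Q)
          {x ∈ Q | ENNReal.ofReal (ω x) ≤ ENNReal.ofReal (Real.exp (-(2 * K + 1))) * avg ω Q} :=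
        (Measure.restrict_eq_self _ (Set.sep_subset _ _)).symm
    _ ≤ (volume.restrict Q) {x | 2 * K ≤ g x} := by
        refine measure_mono_ae ?_
        filter_upwards [hpos] with x hx hx'
        have h1 := hx'.2
        rw [havg, ← ENNReal.ofReal_mul (Real.exp_pos _).le,
          ENNReal.ofReal_le_ofReal_iff (by positivity)] at h1
        have h2 := Real.log_le_log hx h1
        rw [Real.log_mul (Real.exp_pos _).ne' hapos.ne', Real.log_exp] at h2
        have h3 : 0 < ω x / a := div_pos hx hapos
        change 2 * K ≤ g x
        simp only [hg, Real.log_inv]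
        linarith
    _ ≤ ENNReal.ofReal (1 / 2) * volume Q := by
        rw [← ENNReal.ofReal_toReal hfin, ← ENNReal.ofReal_toReal hQt,
          ← ENNReal.ofReal_mul (by norm_num)]
        exact ENNReal.ofReal_le_ofReal hreal

/-! ### From sublevel sets to comparability of proportions -/

/-- If `A` is small, then outside `A` and outside the sublevel set there remains a fixed proportion
of the cube, on which `ω` exceeds `γ` times its average. -/
theorem HasSmallSublevels.smallVolumeBoundsWeight (hω : IsWeight ω) (h : HasSmallSublevels ρ ω) :
    SmallVolumeBoundsWeight ρ ω := by
  obtain ⟨γ, δ, hγ0, hγ1, hδ0, hδ1, h⟩ := h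
  set κ := (1 - δ) / 2 with hκ
  have hκ0 : 0 < κ := by rw [hκ]; linarith
  have hκ1 : κ < 1 := by rw [hκ]; linarith
  have hγκ : γ * κ < 1 := mul_lt_one_of_nonneg_of_lt_one_left hγ0.le hγ1 hκ1.le
  refine ⟨κ, 1 - γ * κ, hκ0, hκ1, by linarith, by linarith [mul_pos hγ0 hκ0], ?_⟩
  intro Q hQ A hAQ hA hsmall
  have hlow := h Q hQ
  obtain ⟨c, l, hl, -, rfl⟩ := hQ
  set Q := cube c l
  have hQ0 := volume_cube_ne_zero c hl
  have hQt := volume_cube_ne_top c l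
  -- `H` is the part of the complement of `A` where `ω` is not small
  set H := {x ∈ Q \ A | ENNReal.ofReal γ * avg ω Q < ENNReal.ofReal (ω x)} with hH
  have hcover : Q ⊆ A ∪
      ({x ∈ Q | ENNReal.ofReal (ω x) ≤ ENNReal.ofReal γ * avg ω Q} ∪ H) := by
    intro x hx
    by_cases hxA : x ∈ A
    · exact Or.inl hxA
    · rcases le_or_gt (ENNReal.ofReal (ω x)) (ENNReal.ofReal γ * avg ω Q) with h1 | h1
      · exact Or.inr (Or.inl ⟨hx, h1⟩)
      · exact Or.inr (Or.inr ⟨⟨hx, hxA⟩, h1⟩)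
  have hHlarge : ENNReal.ofReal κ * volume Q ≤ volume H := by
    have h1 : volume Q ≤ ENNReal.ofReal κ * volume Q +
        (ENNReal.ofReal δ * volume Q + volume H) :=
      (measure_mono hcover).trans ((measure_union_le _ _).trans
        (add_le_add hsmall ((measure_union_le _ _).trans (add_le_add hlow le_rfl))))
    have h2 : volume Q = ENNReal.ofReal κ * volume Q +
        (ENNReal.ofReal δ * volume Q + ENNReal.ofReal κ * volume Q) := by
      rw [← add_mul, ← add_mul, ← ENNReal.ofReal_add hδ0.le hκ0.le,
        ← ENNReal.ofReal_add hκ0.le (by linarith)]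
      have : κ + (δ + κ) = 1 := by rw [hκ]; ring
      rw [this, ENNReal.ofReal_one, one_mul]
    nth_rw 1 [h2] at h1
    exact (ENNReal.add_le_add_iff_left (mul_ne_top ofReal_ne_top hQt)).1
      ((ENNReal.add_le_add_iff_left (mul_ne_top ofReal_ne_top hQt)).1 h1)
  have hwt : ENNReal.ofReal (γ * κ) * wt ω Q ≤ wt ω (Q \ A) := by
    calc ENNReal.ofReal (γ * κ) * wt ω Q
        = ENNReal.ofReal γ * avg ω Q * (ENNReal.ofReal κ * volume Q) := by
          rw [avg_mul_volume_cube ω c hl |>.symm, ENNReal.ofReal_mul hγ0.le]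
          ring
      _ ≤ ENNReal.ofReal γ * avg ω Q * volume H := mul_le_mul_right hHlarge _
      _ ≤ wt ω H := by
          rw [wt, ← setLIntegral_const]
          have hHmeas : NullMeasurableSet H volume := by
            have h1 : NullMeasurableSet
                {x | ENNReal.ofReal γ * avg ω Q < ENNReal.ofReal (ω x)} volume :=
              nullMeasurableSet_lt aemeasurable_const hω.aemeasurable.ennreal_ofReal
            exact ((measurableSet_cube c l).nullMeasurableSet.diff hA).inter h1
          refine lintegral_mono_ae ?_
          refine (ae_restrict_iff'₀ hHmeas).2 (Eventually.of_forall fun x hx => hx.2.le)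
      _ ≤ wt ω (Q \ A) := wt_mono (Set.sep_subset _ _)
  have h1 : wt ω A + ENNReal.ofReal (γ * κ) * wt ω Q ≤ wt ω Q :=
    (add_le_add_right hwt _).trans (wt_add_wt_diff hA hAQ).le
  have h2 : wt ω Q =
      ENNReal.ofReal (1 - γ * κ) * wt ω Q + ENNReal.ofReal (γ * κ) * wt ω Q := by
    rw [← add_mul, ← ENNReal.ofReal_add (by linarith) (by positivity), sub_add_cancel,
      ENNReal.ofReal_one, one_mul]
  nth_rw 2 [h2] at h1
  exact (ENNReal.add_le_add_iff_right
    (mul_ne_top ofReal_ne_top (hω.wt_cube_ne_top c hl))).1 h1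

/-! ### The reverse Hölder inequality -/

theorem volume_cell_le_mul_succ (c : Fin n → ℝ) {l : ℝ} (hl : 0 < l) (m : ℕ) (x : Fin n → ℝ) :
    volume (cell (dyadicIndex c l) m x) ≤
      2 ^ n * volume (cell (dyadicIndex c l) (m + 1) x) := by
  rw [volume_cell_dyadicIndex c hl, volume_cell_dyadicIndex c hl, ← mul_pow]
  have h := ofReal_side (l := l / 2 ^ m) 1
  rw [pow_one, pow_one, ← div_mul_eq_div_div, ← pow_succ] at h
  rw [h]

theorem cell_zero_ae_eq_cube (c : Fin n → ℝ) {l : ℝ} (hl : 0 < l) :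
    cell (dyadicIndex c l) 0 c =ᵐ[volume] cube c l := by
  have h := cell_dyadicIndex_ae_eq_cube c hl 0 c
  rwa [dyadicCenter_zero c hl, pow_zero, div_one] at h

theorem isCubeUpTo_dyadic (c : Fin n → ℝ) {l : ℝ} (hl : 0 < l) (hlρ : l ≤ ρ) (m : ℕ)
    (x : Fin n → ℝ) : IsCubeUpTo ρ (cube (dyadicCenter c l m x) (l / 2 ^ m)) :=
  ⟨_, _, side_pos hl m, (side_le hl m).trans hlρ, rfl⟩

/-- A subset of a half-open dyadic cube agrees almost everywhere with its part in the open cube. -/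
theorem inter_cube_ae_eq (c : Fin n → ℝ) {l : ℝ} (hl : 0 < l) (m : ℕ) (x : Fin n → ℝ)
    {A : Set (Fin n → ℝ)} (hA : A ⊆ cell (dyadicIndex c l) m x) :
    (A ∩ cube (dyadicCenter c l m x) (l / 2 ^ m) : Set (Fin n → ℝ)) =ᵐ[volume] A := by
  have h := (ae_eq_refl A).inter (cell_dyadicIndex_ae_eq_cube c hl m x).symm
  rwa [Set.inter_eq_self_of_subset_left hA] at h

/-- The self-improvement principle for Lebesgue measure and the measure with density `ω`. -/
theorem SmallVolumeBoundsWeight.hasReverseHolder (hω : IsWeight ω)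
    (h : SmallVolumeBoundsWeight ρ ω) : HasReverseHolder ρ ω := by
  obtain ⟨α, β, hα0, hα1, hβ0, hβ1, h⟩ := h
  obtain ⟨ε, hε, K, hK, hmain⟩ := IsNested.exists_lintegral_rpow_le (Ω := Fin n → ℝ)
    (ι := Fin n → ℤ) (α := ENNReal.ofReal α) (β := ENNReal.ofReal β) (D := 2 ^ n)
    (ENNReal.ofReal_pos.2 hα0).ne' (ENNReal.ofReal_le_one.2 hα1.le)
    (ENNReal.ofReal_lt_one.2 hβ1) (one_le_pow_of_one_le' one_le_two n) (by simp)
  have hε1 : 0 < 1 + ε := by linarith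
  have hKt : K ^ (1 / (1 + ε)) ≠ ⊤ := rpow_ne_top_of_nonneg (by positivity) hK
  refine ⟨(K ^ (1 / (1 + ε))).toReal + 1, ε, by positivity, hε, ?_⟩
  rintro Q ⟨c, l, hl, hlρ, rfl⟩
  have hQ0 := volume_cube_ne_zero c hl
  have hQt := volume_cube_ne_top c l
  have hcell := cell_zero_ae_eq_cube c hl
  have hv := measure_congr hcell
  have hw := wt_congr (ω := ω) hcell
  have key := hmain (isNested_dyadicIndex c hl) (μ := volume) (ν := wtMeasure ω) (x₀ := c)
    (f := fun x => ENNReal.ofReal (ω x)) (fun m x _ => volume_cell_le_mul_succ c hl m x)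
    (fun m x _ A hA hAm hsmall => by
      have hae := inter_cube_ae_eq c hl m x hA
      have h1 := h _ (isCubeUpTo_dyadic c hl hlρ m x) _ Set.inter_subset_right
        (hAm.inter (measurableSet_cube _ _)).nullMeasurableSet
      rw [measure_congr hae, wt_congr hae, ← measure_congr (cell_dyadicIndex_ae_eq_cube c hl m x),
        ← wt_congr (cell_dyadicIndex_ae_eq_cube c hl m x)] at h1
      simpa only [wtMeasure_apply] using h1 hsmall)
    (by rwa [hv]) (by rwa [hv]) (by rw [wtMeasure_apply, hw]; exact hω.wt_cube_ne_zero c hl)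
    (by rw [wtMeasure_apply, hw]; exact hω.wt_cube_ne_top c hl)
    (ae_restrict_of_ae ((wtMeasure_absolutelyContinuous ω).ae_le (by
      filter_upwards [hω.ae_tendsto_avg_cell c hl] with x hx t ht
      refine le_of_tendsto' hx fun m => ?_
      rw [avg, ← wtMeasure_apply]
      exact ENNReal.div_le_of_le_mul (ht m))))
  have hlhs : ∫⁻ x in cell (dyadicIndex c l) 0 c, ENNReal.ofReal (ω x) ^ ε ∂wtMeasure ω =
      ∫⁻ x in cube c l, ENNReal.ofReal (ω x) ^ (1 + ε) := by
    rw [wtMeasure, setLIntegral_withDensity_eq_setLIntegral_mul_non_measurable₀ _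
      hω.aemeasurable.ennreal_ofReal.restrict _
      ((isNested_dyadicIndex c hl).measurableSet_cell 0 c)
      (Eventually.of_forall fun _ => ofReal_lt_top), setLIntegral_congr hcell]
    refine lintegral_congr_ae (Eventually.of_forall fun x => ?_)
    simp only [Pi.mul_apply]
    rw [ENNReal.rpow_add_of_nonneg _ _ zero_le_one hε.le, ENNReal.rpow_one]
  rw [hlhs, hv, wtMeasure_apply, hw] at key
  have hdiv : (∫⁻ x in cube c l, ENNReal.ofReal (ω x) ^ (1 + ε)) / volume (cube c l) ≤
      K * avg ω (cube c l) ^ (1 + ε) := by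
    refine ENNReal.div_le_of_le_mul (key.trans (le_of_eq ?_))
    rw [← avg, ENNReal.rpow_add_of_nonneg _ _ zero_le_one hε.le, ENNReal.rpow_one]
    rw [← avg_mul_volume_cube ω c hl]
    ring
  calc _ ≤ (K * avg ω (cube c l) ^ (1 + ε)) ^ (1 / (1 + ε)) :=
        ENNReal.rpow_le_rpow hdiv (by positivity)
    _ = K ^ (1 / (1 + ε)) * avg ω (cube c l) := by
        rw [ENNReal.mul_rpow_of_nonneg _ _ (by positivity), ← ENNReal.rpow_mul,
          mul_one_div_cancel hε1.ne', ENNReal.rpow_one]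
    _ ≤ _ := by
        refine mul_le_mul_left ?_ _
        refine (ENNReal.le_ofReal_iff_toReal_le hKt (by positivity)).2 (by linarith)

/-- Hölder's inequality on `A`. -/
theorem HasReverseHolder.hasPowerBound (hω : IsWeight ω) (h : HasReverseHolder ρ ω) :
    HasPowerBound ρ ω := by
  obtain ⟨C₁, ε, hC₁, hε, h⟩ := h
  have hε1 : 0 < 1 + ε := by linarith
  refine ⟨C₁, ε / (1 + ε), hC₁, by positivity, fun Q hQ A hAQ _ => ?_⟩
  have hrh := h Q hQ
  obtain ⟨c, l, hl, -, rfl⟩ := hQ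
  have hQ0 := volume_cube_ne_zero c hl
  have hQt := volume_cube_ne_top c l
  set Q := cube c l with hQdef
  set J := ∫⁻ x in Q, ENNReal.ofReal (ω x) ^ (1 + ε) with hJ
  have hconj : (1 + ε).HolderConjugate ((1 + ε) / ε) := by
    rw [Real.holderConjugate_iff]
    refine ⟨by linarith, ?_⟩
    field_simp
  have hholder := ENNReal.lintegral_mul_le_Lp_mul_Lq (volume.restrict A) hconj
    (f := fun x => ENNReal.ofReal (ω x)) (g := fun _ => 1)
    hω.aemeasurable.restrict.ennreal_ofReal aemeasurable_const
  simp only [Pi.mul_apply, mul_one, ENNReal.one_rpow, lintegral_one, Measure.restrict_apply_univ,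
    one_div_div] at hholder
  refine ENNReal.div_le_of_le_mul ?_
  have hsplit : ∀ V : ℝ≥0∞, V ≠ 0 → V ≠ ⊤ → V ^ (1 / (1 + ε)) = V * (V ^ (ε / (1 + ε)))⁻¹ := by
    intro V hV0 hVt
    rw [← ENNReal.rpow_neg]
    nth_rw 2 [← ENNReal.rpow_one V]
    rw [← ENNReal.rpow_add _ _ hV0 hVt]
    congr 1
    field_simp
    ring
  calc wt ω A ≤ (∫⁻ x in A, ENNReal.ofReal (ω x) ^ (1 + ε)) ^ (1 / (1 + ε)) *
        volume A ^ (ε / (1 + ε)) := hholder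
    _ ≤ J ^ (1 / (1 + ε)) * volume A ^ (ε / (1 + ε)) := by
        exact mul_le_mul_left (ENNReal.rpow_le_rpow (lintegral_mono_set hAQ) (by positivity)) _
    _ = (J / volume Q) ^ (1 / (1 + ε)) * volume Q ^ (1 / (1 + ε)) *
          volume A ^ (ε / (1 + ε)) := by
        rw [← ENNReal.mul_rpow_of_nonneg _ _ (by positivity), ENNReal.div_mul_cancel hQ0 hQt]
    _ ≤ ENNReal.ofReal C₁ * avg ω Q * volume Q ^ (1 / (1 + ε)) * volume A ^ (ε / (1 + ε)) := by
        gcongr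
    _ = ENNReal.ofReal C₁ * (volume A / volume Q) ^ (ε / (1 + ε)) * wt ω Q := by
        rw [hsplit _ hQ0 hQt, ENNReal.div_rpow_of_nonneg _ _ (by positivity),
          ← avg_mul_volume_cube ω c hl]
        simp only [div_eq_mul_inv]
        ring

/-! ### Change of scale -/

/-- The power bound passes from smaller to larger cubes without any doubling property: the bounds
on the dyadic subcubes of a fixed small level are summed. -/
theorem HasPowerBound.change_scale (hω : IsWeight ω) (hρ : 0 < ρ) (h : HasPowerBound ρ ω)
    (ρ' : ℝ) : HasPowerBound ρ' ω := by
  obtain ⟨C₂, ε₀, hC₂, hε₀, h⟩ := h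
  obtain ⟨m, hm⟩ : ∃ m : ℕ, ρ' / 2 ^ m ≤ ρ := by
    obtain ⟨m, hm⟩ := pow_unbounded_of_one_lt (ρ' / ρ) (one_lt_two (α := ℝ))
    refine ⟨m, ?_⟩
    rw [div_le_iff₀ (by positivity), ← div_le_iff₀' hρ]
    exact hm.le
  refine ⟨C₂ * ((2 ^ m) ^ n) ^ ε₀, ε₀, by positivity, hε₀, ?_⟩
  rintro Q ⟨c, l, hl, hlρ, rfl⟩ A hAQ hA
  have hQ0 := volume_cube_ne_zero c hl
  have hQt := volume_cube_ne_top c l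
  have hN := isNested_dyadicIndex c hl
  have hcell := cell_zero_ae_eq_cube c hl
  set k : ℝ≥0∞ := ENNReal.ofReal (C₂ * ((2 ^ m) ^ n) ^ ε₀) *
    (volume A / volume (cube c l)) ^ ε₀ with hk
  refine ENNReal.div_le_of_le_mul ?_
  have hsum := (hN.isCellUnion_cell (Nat.zero_le m) c).measure_le hN
    (μ := (wtMeasure ω).restrict A) (ν := k • wtMeasure ω) fun x _ => ?_
  · rw [Measure.smul_apply, smul_eq_mul, wtMeasure_apply, wt_congr hcell] at hsum
    refine le_trans ?_ hsum
    rw [Measure.restrict_apply (hN.measurableSet_cell 0 c), wtMeasure_apply,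
      wt_congr (hcell.inter (ae_eq_refl A)), Set.inter_eq_self_of_subset_right hAQ]
  · set q := cube (dyadicCenter c l m x) (l / 2 ^ m) with hq
    have hl' := side_pos hl m
    have hae : cell (dyadicIndex c l) m x =ᵐ[volume] q := cell_dyadicIndex_ae_eq_cube c hl m x
    have h1 := h q ⟨_, _, hl', le_trans (by gcongr) hm, rfl⟩ (q ∩ A)
      Set.inter_subset_left ((measurableSet_cube _ _).nullMeasurableSet.inter hA)
    have h2 := (ENNReal.div_le_iff (hω.wt_cube_ne_zero _ hl') (hω.wt_cube_ne_top _ hl')).1 h1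
    rw [Measure.restrict_apply (hN.measurableSet_cell m x), Measure.smul_apply, smul_eq_mul,
      wtMeasure_apply, wtMeasure_apply, wt_congr (hae.inter (ae_eq_refl A)), wt_congr hae]
    refine h2.trans (mul_le_mul_left ?_ _)
    have hvol : volume (cube c l) = (2 ^ m) ^ n * volume q := by
      rw [volume_cube, hq, volume_cube, ← mul_pow, ← ofReal_side]
    have hfac : ENNReal.ofReal (((2 ^ m) ^ n) ^ ε₀) = ((2 ^ m) ^ n : ℝ≥0∞) ^ ε₀ := by
      rw [← ENNReal.ofReal_rpow_of_nonneg (by positivity) hε₀.le,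
        ENNReal.ofReal_pow (by positivity), ENNReal.ofReal_pow (by positivity),
        ENNReal.ofReal_ofNat]
    rw [hk, ENNReal.ofReal_mul hC₂.le, mul_assoc, hfac,
      ← ENNReal.mul_rpow_of_nonneg _ _ hε₀.le]
    refine mul_le_mul_right (ENNReal.rpow_le_rpow ?_ hε₀.le) _
    have h20 : ((2 ^ m) ^ n : ℝ≥0∞) ≠ 0 := by simp
    have h2t : ((2 ^ m) ^ n : ℝ≥0∞) ≠ ⊤ := by simp
    rw [hvol, ← mul_div_assoc, ENNReal.mul_div_mul_left _ _ h20 h2t]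
    exact ENNReal.div_le_div_right (measure_mono Set.inter_subset_right) _

/-! ### Exchanging the roles of the two measures -/

/-- The power bound is applied to the complement of `A`. -/
theorem HasPowerBound.smallWeightBoundsVolume (hω : IsWeight ω) (h : HasPowerBound ρ ω) :
    SmallWeightBoundsVolume ρ ω := by
  obtain ⟨C₂, ε₀, hC₂, hε₀, h⟩ := h
  -- `η` is chosen such that `C₂ * η ^ ε₀ ≤ 1 / 2`
  set η := min (1 / 2) ((1 / (2 * C₂)) ^ (1 / ε₀)) with hη
  have hη0 : 0 < η := lt_min (by norm_num) (by positivity)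
  have hη1 : η ≤ 1 / 2 := min_le_left _ _
  have hηC : C₂ * η ^ ε₀ ≤ 1 / 2 := by
    have h1 : η ^ ε₀ ≤ 1 / (2 * C₂) := by
      calc η ^ ε₀ ≤ ((1 / (2 * C₂)) ^ (1 / ε₀)) ^ ε₀ :=
            Real.rpow_le_rpow hη0.le (min_le_right _ _) hε₀.le
        _ = 1 / (2 * C₂) := by
            rw [← Real.rpow_mul (by positivity), one_div_mul_cancel hε₀.ne', Real.rpow_one]
    calc C₂ * η ^ ε₀ ≤ C₂ * (1 / (2 * C₂)) := mul_le_mul_of_nonneg_left h1 hC₂.le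
      _ = 1 / 2 := by field_simp
  refine ⟨1 / 2, 1 - η, by norm_num, by norm_num, by linarith, by linarith, ?_⟩
  intro Q hQ A hAQ hA hsmall
  have hpow := h Q hQ (Q \ A) Set.sdiff_subset
  obtain ⟨c, l, hl, -, rfl⟩ := hQ
  have hQ0 := volume_cube_ne_zero c hl
  have hQt := volume_cube_ne_top c l
  have hw0 := hω.wt_cube_ne_zero c hl
  have hwt := hω.wt_cube_ne_top c hl
  have hpow := hpow ((measurableSet_cube c l).nullMeasurableSet.diff hA)
  set Q := cube c l
  by_contra! hcon
  have hvol : volume (Q \ A) ≤ ENNReal.ofReal η * volume Q := by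
    have h1 : volume A + volume (Q \ A) = volume Q := by
      have := measure_inter_add_sdiff₀ (μ := volume) Q hA
      rwa [Set.inter_eq_self_of_subset_right hAQ] at this
    have h2 : volume Q = ENNReal.ofReal (1 - η) * volume Q + ENNReal.ofReal η * volume Q := by
      rw [← add_mul, ← ENNReal.ofReal_add (by linarith) hη0.le, sub_add_cancel, ENNReal.ofReal_one,
        one_mul]
    have h3 := (add_le_add_left hcon (volume (Q \ A))).trans_eq (h1.trans h2)
    exact (ENNReal.add_le_add_iff_left (mul_ne_top ofReal_ne_top hQt)).1 h3
  have hdiff : wt ω (Q \ A) ≤ ENNReal.ofReal (1 / 2) * wt ω Q := by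
    rw [ENNReal.div_le_iff hw0 hwt] at hpow
    refine hpow.trans (mul_le_mul_left ?_ _)
    calc ENNReal.ofReal C₂ * (volume (Q \ A) / volume Q) ^ ε₀
        ≤ ENNReal.ofReal C₂ * ENNReal.ofReal η ^ ε₀ :=
          mul_le_mul_right (ENNReal.rpow_le_rpow (ENNReal.div_le_of_le_mul hvol) hε₀.le) _
      _ = ENNReal.ofReal (C₂ * η ^ ε₀) := by
          rw [ENNReal.ofReal_rpow_of_nonneg hη0.le hε₀.le, ← ENNReal.ofReal_mul hC₂.le]
      _ ≤ ENNReal.ofReal (1 / 2) := ENNReal.ofReal_le_ofReal hηC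
  have hlt : wt ω Q < wt ω Q := by
    calc wt ω Q = wt ω A + wt ω (Q \ A) := (wt_add_wt_diff hA hAQ).symm
      _ < ENNReal.ofReal (1 / 2) * wt ω Q + ENNReal.ofReal (1 / 2) * wt ω Q :=
          ENNReal.add_lt_add_of_lt_of_le
            (ne_top_of_le_ne_top (mul_ne_top ofReal_ne_top hwt) hdiff) hsmall hdiff
      _ = wt ω Q := by
          rw [← add_mul, ← ENNReal.ofReal_add (by norm_num) (by norm_num)]
          norm_num
  exact lt_irrefl _ hlt

/-- The weighted measure is doubling on dyadic cubes. A half-size subcube is joined to the full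
cube by finitely many nested cubes, consecutive ones having nearly equal volumes. -/
theorem SmallWeightBoundsVolume.exists_doubling (h : SmallWeightBoundsVolume ρ ω) :
    ∃ D : ℝ≥0∞, 1 ≤ D ∧ D ≠ ⊤ ∧ ∀ (c c' : Fin n → ℝ) (l : ℝ), 0 < l → l ≤ ρ →
      (∀ i, |c' i - c i| ≤ l / 4) → wt ω (cube c l) ≤ D * wt ω (cube c' (l / 2)) := by
  obtain ⟨α, β, hα0, hα1, hβ0, hβ1, h⟩ := h
  -- consecutive sides in a chain of `N` steps have ratio at least `N / (N + 1)`
  obtain ⟨N, hN0, hN⟩ : ∃ N : ℕ, 0 < N ∧ β ≤ ((N : ℝ) / (N + 1)) ^ n := by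
    have hlim : Tendsto (fun N : ℕ => ((N : ℝ) / (N + 1)) ^ n) atTop (𝓝 (1 ^ n)) :=
      (tendsto_natCast_div_add_atTop (1 : ℝ)).pow n
    rw [one_pow] at hlim
    obtain ⟨N, hN, hN0⟩ := ((hlim.eventually_const_le hβ1).and (eventually_gt_atTop 0)).exists
    exact ⟨N, hN0, hN⟩
  have hNpos : (0 : ℝ) < N := Nat.cast_pos.2 hN0
  have hα0' : ENNReal.ofReal α ≠ 0 := (ENNReal.ofReal_pos.2 hα0).ne'
  have hpow0 : ∀ k, ENNReal.ofReal α ^ k ≠ 0 := fun k => pow_ne_zero k hα0'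
  refine ⟨(ENNReal.ofReal α ^ N)⁻¹,
    ENNReal.one_le_inv.2 (pow_le_one' (ENNReal.ofReal_le_one.2 hα1.le) N),
    ENNReal.inv_ne_top.2 (hpow0 N), fun c c' l hl hlρ hcc => ?_⟩
  -- the cubes interpolate linearly between `cube c' (l / 2)` and `cube c l`
  set q : ℕ → Set (Fin n → ℝ) := fun k =>
    cube (fun i => c' i + k / N * (c i - c' i)) ((1 + k / N) * (l / 2)) with hq
  have hqpos : ∀ k : ℕ, 0 < (1 + (k : ℝ) / N) * (l / 2) := fun k => by positivity
  have hsub : ∀ k, q k ⊆ q (k + 1) := by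
    intro k x hx i
    have h1 := hx i
    have h2 := hcc i
    have h3 : (0 : ℝ) < 1 / N := by positivity
    have h4 : ((k + 1 : ℕ) : ℝ) / N = k / N + 1 / N := by push_cast; ring
    simp only [h4]
    rw [abs_lt] at h1 ⊢
    rw [abs_le] at h2
    constructor <;> nlinarith
  have hstep : ∀ k < N, ENNReal.ofReal α * wt ω (q (k + 1)) ≤ wt ω (q k) := by
    intro k hk
    by_contra! hcon
    have hside : (1 + ((k + 1 : ℕ) : ℝ) / N) * (l / 2) ≤ ρ := by
      have h1 : ((k + 1 : ℕ) : ℝ) / N ≤ 1 := by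
        rw [div_le_one hNpos]
        exact_mod_cast hk
      nlinarith
    have hlt := h (q (k + 1)) ⟨_, _, hqpos (k + 1), hside, rfl⟩ (q k) (hsub k)
      (measurableSet_cube _ _).nullMeasurableSet hcon
    refine hlt.not_ge ?_
    simp only [hq]
    rw [volume_cube, volume_cube, ← ENNReal.ofReal_pow (hqpos _).le,
      ← ENNReal.ofReal_pow (hqpos _).le, ← ENNReal.ofReal_mul hβ0.le]
    refine ENNReal.ofReal_le_ofReal ?_
    calc β * ((1 + ((k + 1 : ℕ) : ℝ) / N) * (l / 2)) ^ n
        ≤ ((N : ℝ) / (N + 1)) ^ n * ((1 + ((k + 1 : ℕ) : ℝ) / N) * (l / 2)) ^ n :=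
          mul_le_mul_of_nonneg_right hN (by positivity)
      _ = ((N : ℝ) / (N + 1) * ((1 + ((k + 1 : ℕ) : ℝ) / N) * (l / 2))) ^ n := (mul_pow _ _ _).symm
      _ ≤ ((1 + (k : ℝ) / N) * (l / 2)) ^ n := by
          refine pow_le_pow_left₀ (by positivity) ?_ n
          rw [← mul_assoc]
          refine mul_le_mul_of_nonneg_right ?_ (half_pos hl).le
          push_cast
          rw [div_mul_eq_mul_div, div_le_iff₀ (by positivity)]
          have hk0 : (0 : ℝ) ≤ k / N := by positivity
          field_simp
          nlinarith
  have hchain : ∀ k ≤ N, ENNReal.ofReal α ^ k * wt ω (q k) ≤ wt ω (q 0) := by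
    intro k
    induction k with
    | zero => simp
    | succ k ih =>
      intro hk
      calc ENNReal.ofReal α ^ (k + 1) * wt ω (q (k + 1))
          = ENNReal.ofReal α ^ k * (ENNReal.ofReal α * wt ω (q (k + 1))) := by ring
        _ ≤ ENNReal.ofReal α ^ k * wt ω (q k) := mul_le_mul_right (hstep k hk) _
        _ ≤ wt ω (q 0) := ih (Nat.le_of_succ_le hk)
  have hq0 : q 0 = cube c' (l / 2) := by simp [hq]
  have hqN : q N = cube c l := by
    simp only [hq, div_self hNpos.ne']
    congr 1
    · ext i
      ring
    · ring
  have := hchain N le_rfl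
  rw [hq0, hqN] at this
  rw [mul_comm, ← div_eq_mul_inv,
    ENNReal.le_div_iff_mul_le (Or.inl (hpow0 N)) (Or.inl (pow_ne_top ofReal_ne_top)), mul_comm]
  exact this

/-- The reverse Hölder inequality for the density `ω⁻¹` of Lebesgue measure with respect to the
weighted measure is an `A_p` condition, with `p = 1 + 1 / ε`. -/
theorem SmallWeightBoundsVolume.exists_apConst_le (hω : IsWeight ω)
    (h : SmallWeightBoundsVolume ρ ω) :
    ∃ p C₃ : ℝ, 1 ≤ p ∧ apConst p ρ ω ≤ ENNReal.ofReal C₃ := by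
  obtain ⟨D, hD1, hDt, hdoub⟩ := h.exists_doubling
  obtain ⟨α, β, hα0, hα1, hβ0, hβ1, h⟩ := h
  -- the hypothesis has a strict inequality, hence `α / 2` in place of `α`
  obtain ⟨ε, hε, K, hK, hmain⟩ := IsNested.exists_lintegral_rpow_le (Ω := Fin n → ℝ)
    (ι := Fin n → ℤ) (α := ENNReal.ofReal (α / 2)) (β := ENNReal.ofReal β) (D := D)
    (ENNReal.ofReal_pos.2 (half_pos hα0)).ne' (ENNReal.ofReal_le_one.2 (by linarith))
    (ENNReal.ofReal_lt_one.2 hβ1) hD1 hDt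
  have hKt : K ^ (1 / ε) ≠ ⊤ := rpow_ne_top_of_nonneg (by positivity) hK
  refine ⟨1 + 1 / ε, (K ^ (1 / ε)).toReal, by linarith [one_div_pos.2 hε], ?_⟩
  rw [ENNReal.ofReal_toReal hKt, apConst]
  refine iSup₂_le ?_
  rintro Q ⟨c, l, hl, hlρ, rfl⟩
  rw [if_neg (by linarith [one_div_pos.2 hε]), add_sub_cancel_left, one_div_one_div]
  have hcell := cell_zero_ae_eq_cube c hl
  have hv := measure_congr hcell
  have hw := wt_congr (ω := ω) hcell
  have key := hmain (isNested_dyadicIndex c hl) (μ := wtMeasure ω) (ν := volume) (x₀ := c)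
    (f := fun x => (ENNReal.ofReal (ω x))⁻¹)
    (fun m x _ => by
      have h1 := hdoub _ _ _ (side_pos hl m) ((side_le hl m).trans hlρ)
        (abs_dyadicCenter_succ_sub_le c hl m x)
      rw [← div_mul_eq_div_div, ← pow_succ, ← wt_congr (cell_dyadicIndex_ae_eq_cube c hl m x),
        ← wt_congr (cell_dyadicIndex_ae_eq_cube c hl (m + 1) x)] at h1
      simpa only [wtMeasure_apply] using h1)
    (fun m x _ A hA hAm hsmall => by
      have hae := inter_cube_ae_eq c hl m x hA
      have hq := cell_dyadicIndex_ae_eq_cube c hl m x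
      rw [wtMeasure_apply, wtMeasure_apply, wt_congr hq] at hsmall
      have h1 := h _ (isCubeUpTo_dyadic c hl hlρ m x) _ Set.inter_subset_right
        (hAm.inter (measurableSet_cube _ _)).nullMeasurableSet
      rw [measure_congr hae, wt_congr hae, ← measure_congr hq] at h1
      refine (h1 (hsmall.trans_lt ?_)).le
      exact ENNReal.mul_lt_mul_left (hω.wt_cube_ne_zero _ (side_pos hl m))
        (hω.wt_cube_ne_top _ (side_pos hl m))
        ((ENNReal.ofReal_lt_ofReal_iff hα0).2 (half_lt_self hα0)))
    (by rw [wtMeasure_apply, hw]; exact hω.wt_cube_ne_zero c hl)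
    (by rw [wtMeasure_apply, hw]; exact hω.wt_cube_ne_top c hl)
    (by rw [hv]; exact volume_cube_ne_zero c hl) (by rw [hv]; exact volume_cube_ne_top c l)
    (ae_restrict_of_ae (by
      filter_upwards [hω.ae_tendsto_avg_cell c hl] with x hx t ht
      rw [ENNReal.inv_le_iff_inv_le]
      refine ge_of_tendsto' hx fun m => ?_
      have hm := ht m
      have hq := cell_dyadicIndex_ae_eq_cube c hl m x
      rw [wtMeasure_apply] at hm
      have h0 : volume (cell (dyadicIndex c l) m x) ≠ 0 := by
        rw [measure_congr hq]; exact volume_cube_ne_zero _ (side_pos hl m)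
      have h0t : volume (cell (dyadicIndex c l) m x) ≠ ⊤ := by
        rw [measure_congr hq]; exact volume_cube_ne_top _ _
      rw [avg, ENNReal.le_div_iff_mul_le (Or.inl h0) (Or.inl h0t), mul_comm, ← div_eq_mul_inv]
      exact ENNReal.div_le_of_le_mul' hm))
  rw [hv, wtMeasure_apply, hw, setLIntegral_congr hcell] at key
  have havg0 := hω.avg_cube_ne_zero c hl
  have havgt := hω.avg_cube_ne_top c hl
  have hinv : volume (cube c l) / wt ω (cube c l) = (avg ω (cube c l))⁻¹ := by
    rw [avg, ENNReal.inv_div (Or.inl (volume_cube_ne_top c l))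
      (Or.inl (volume_cube_ne_zero c hl))]
  calc avg ω (cube c l) *
        ((∫⁻ x in cube c l, ENNReal.ofReal (ω x) ^ (-ε)) / volume (cube c l)) ^ (1 / ε)
      ≤ avg ω (cube c l) * (K * (avg ω (cube c l))⁻¹ ^ ε) ^ (1 / ε) := by
        refine mul_le_mul_right (ENNReal.rpow_le_rpow (ENNReal.div_le_of_le_mul ?_)
          (by positivity)) _
        rw [← hinv]
        simpa only [ENNReal.rpow_neg, ENNReal.inv_rpow] using key
    _ = K ^ (1 / ε) := by
        rw [ENNReal.mul_rpow_of_nonneg _ _ (by positivity), ← ENNReal.rpow_mul,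
          mul_one_div_cancel hε.ne', ENNReal.rpow_one, mul_left_comm,
          ENNReal.mul_inv_cancel havg0 havgt, mul_one]

/-! ### From an `A_p` condition to the logarithmic condition -/

/-- Jensen's inequality for the exponential function. -/
theorem IsWeight.expAvgLogInv_le (hω : IsWeight ω) (c : Fin n → ℝ) {l : ℝ} (hl : 0 < l) {ε : ℝ}
    (hε : 0 < ε) :
    expAvgLogInv ω (cube c l) ≤
      ((∫⁻ x in cube c l, ENNReal.ofReal (ω x) ^ (-ε)) / volume (cube c l)) ^ (1 / ε) := by
  have hQ0 := volume_cube_ne_zero c hl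
  have hQt := volume_cube_ne_top c l
  obtain htop | hfin := eq_or_ne (∫⁻ x in cube c l, ENNReal.ofReal (ω x) ^ (-ε)) ⊤
  · rw [htop, ENNReal.top_div_of_ne_top hQt, ENNReal.top_rpow_of_pos (by positivity)]
    exact le_top
  set g : (Fin n → ℝ) → ℝ := fun x => ε * Real.log (ω x)⁻¹ with hg
  have hpos : ∀ᵐ x ∂volume.restrict (cube c l), 0 < ω x := ae_restrict_of_ae hω.ae_pos
  have hexp : (fun x => ENNReal.ofReal (Real.exp (g x))) =ᵐ[volume.restrict (cube c l)]
      fun x => ENNReal.ofReal (ω x) ^ (-ε) := by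
    filter_upwards [hpos] with x hx
    rw [ENNReal.ofReal_rpow_of_pos hx, Real.rpow_def_of_pos hx]
    simp only [hg, Real.log_inv]
    congr 2
    ring
  have hlogint : IntegrableOn (fun x => Real.log (ω x)⁻¹) (cube c l) volume := by
    by_contra hn
    have htop := (lintegral_log_inv_eq_top hω ⟨c, l, hl, le_refl l, rfl⟩).2 hn
    refine (lt_top_iff_ne_top.1 (lt_of_le_of_lt ?_
      (ENNReal.mul_lt_top (ofReal_lt_top (r := ε⁻¹)) hfin.lt_top))) htop
    rw [← lintegral_congr_ae hexp, ← lintegral_const_mul' _ _ ofReal_ne_top]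
    refine lintegral_mono fun x => ?_
    rw [← ENNReal.ofReal_mul (by positivity)]
    refine ENNReal.ofReal_le_ofReal ?_
    rw [← div_eq_inv_mul, le_div_iff₀ hε, mul_comm]
    linarith [Real.add_one_le_exp (g x)]
  have hgint : IntegrableOn g (cube c l) volume := hlogint.const_mul ε
  have hexpint : IntegrableOn (fun x => Real.exp (g x)) (cube c l) volume := by
    refine ⟨Real.continuous_exp.comp_aestronglyMeasurable hgint.aestronglyMeasurable, ?_⟩
    rw [hasFiniteIntegral_iff_ofReal (Eventually.of_forall fun x => (Real.exp_pos _).le)]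
    exact (lintegral_congr_ae hexp).trans_lt hfin.lt_top
  have hjensen := convexOn_exp.map_set_average_le Real.continuous_exp.continuousOn isClosed_univ
    hQ0 hQt (Eventually.of_forall fun _ => Set.mem_univ _) hgint hexpint
  have hright : ENNReal.ofReal (⨍ x in cube c l, Real.exp (g x)) =
      (∫⁻ x in cube c l, ENNReal.ofReal (ω x) ^ (-ε)) / volume (cube c l) := by
    rw [← lintegral_congr_ae hexp, setAverage_eq, smul_eq_mul, mul_comm, ← div_eq_mul_inv,
      measureReal_def, ENNReal.ofReal_div_of_pos (ENNReal.toReal_pos hQ0 hQt),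
      ENNReal.ofReal_toReal hQt, ← ofReal_integral_eq_lintegral_ofReal hexpint
        (Eventually.of_forall fun x => (Real.exp_pos _).le)]
  have hleft : ⨍ x in cube c l, g x =
      ((volume.real (cube c l))⁻¹ * ∫ x in cube c l, Real.log (ω x)⁻¹) * ε := by
    rw [setAverage_eq, hg, integral_const_mul, smul_eq_mul]
    ring
  rw [expAvgLogInv, if_pos hlogint, ← hright]
  calc ENNReal.ofReal (Real.exp ((volume.real (cube c l))⁻¹ * ∫ x in cube c l, Real.log (ω x)⁻¹))
      = ENNReal.ofReal (Real.exp (⨍ x in cube c l, g x)) ^ (1 / ε) := by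
        rw [ENNReal.ofReal_rpow_of_pos (Real.exp_pos _), ← Real.exp_mul, hleft, mul_assoc,
          mul_one_div_cancel hε.ne', mul_one]
    _ ≤ _ := ENNReal.rpow_le_rpow (ENNReal.ofReal_le_ofReal hjensen) (by positivity)

theorem apConst_two_le_apConst_one : apConst 2 ρ ω ≤ apConst 1 ρ ω := by
  rw [apConst, apConst]
  refine iSup₂_mono ?_
  rintro Q ⟨c, l, hl, -, rfl⟩
  rw [if_neg (by norm_num), if_pos rfl]
  refine mul_le_mul_right ?_ _
  norm_num [ENNReal.rpow_neg_one]
  refine ENNReal.div_le_of_le_mul ?_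
  calc ∫⁻ x in cube c l, (ENNReal.ofReal (ω x))⁻¹
      ≤ ∫⁻ _ in cube c l, essSup (fun x => (ENNReal.ofReal (ω x))⁻¹)
          (volume.restrict (cube c l)) := lintegral_mono_ae (ENNReal.ae_le_essSup _)
    _ = _ := by simp

theorem IsWeight.aInftyConst_le_apConst (hω : IsWeight ω) {p : ℝ} (hp : 1 ≤ p) :
    aInftyConst ρ ω ≤ apConst p ρ ω := by
  have hlarge : ∀ p : ℝ, 1 < p → aInftyConst ρ ω ≤ apConst p ρ ω := by
    intro p hp
    rw [aInftyConst, apConst]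
    refine iSup₂_mono ?_
    rintro Q ⟨c, l, hl, -, rfl⟩
    rw [if_neg hp.ne']
    have h := hω.expAvgLogInv_le c hl (one_div_pos.2 (sub_pos.2 hp))
    rw [one_div_one_div] at h
    exact mul_le_mul_right h _
  rcases hp.eq_or_lt with rfl | hp
  · exact (hlarge 2 one_lt_two).trans apConst_two_le_apConst_one
  · exact hlarge p hp

/-! ### Independence of the scale -/

theorem IsWeight.mem_aInftyLocAt_of_apConst_le (hω : IsWeight ω)
    (h : ∃ p C₃ : ℝ, 1 ≤ p ∧ apConst p ρ ω ≤ ENNReal.ofReal C₃) : ω ∈ AInftyLocAt n ρ := by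
  obtain ⟨p, C₃, hp, h⟩ := h
  exact ⟨hω, ((hω.aInftyConst_le_apConst hp).trans h).trans_lt ENNReal.ofReal_lt_top⟩

theorem hasPowerBound_of_mem_aInfty (h : ω ∈ AInftyLocAt n ρ) : HasPowerBound ρ ω :=
  (((HasSmallSublevels.of_mem_aInfty h).smallVolumeBoundsWeight h.1).hasReverseHolder
    h.1).hasPowerBound h.1

theorem IsWeight.exists_apConst_le_iff_exists_mem_apLoc (hω : IsWeight ω) (hρ : 0 < ρ) :
    (∃ p C₃ : ℝ, 1 ≤ p ∧ apConst p ρ ω ≤ ENNReal.ofReal C₃) ↔ ∃ p : ℝ, 1 ≤ p ∧ ω ∈ ApLoc n p := by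
  have hscale : ∀ {r s : ℝ}, 0 < r →
      (∃ p C₃ : ℝ, 1 ≤ p ∧ apConst p r ω ≤ ENNReal.ofReal C₃) →
      ∃ p C₃ : ℝ, 1 ≤ p ∧ apConst p s ω ≤ ENNReal.ofReal C₃ := fun hr h =>
    (((hasPowerBound_of_mem_aInfty (hω.mem_aInftyLocAt_of_apConst_le h)).change_scale hω hr
      _).smallWeightBoundsVolume hω).exists_apConst_le hω
  constructor
  · intro h
    obtain ⟨p, C₃, hp, h⟩ := hscale (s := 1) hρ h
    exact ⟨p, hp, hω, h.trans_lt ENNReal.ofReal_lt_top⟩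
  · rintro ⟨p, hp, -, h⟩
    exact hscale one_pos ⟨p, _, hp, (ENNReal.ofReal_toReal h.ne).ge⟩

/-- Membership in `A_{∞;ρ}` is characterised without reference to `ρ`. -/
theorem mem_aInftyLocAt_iff (hρ : 0 < ρ) :
    ω ∈ AInftyLocAt n ρ ↔ ∃ p : ℝ, 1 ≤ p ∧ ω ∈ ApLoc n p := by
  constructor
  · intro h
    exact (h.1.exists_apConst_le_iff_exists_mem_apLoc hρ).1
      (((hasPowerBound_of_mem_aInfty h).smallWeightBoundsVolume h.1).exists_apConst_le h.1)
  · intro h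
    have hω : IsWeight ω := h.choose_spec.2.1
    exact hω.mem_aInftyLocAt_of_apConst_le ((hω.exists_apConst_le_iff_exists_mem_apLoc hρ).2 h)

end LocalMuckenhoupt

theorem mainTheorem12 (n : ℕ) (hn : 0 < n) :
    (∀ (ρ : ℝ), 0 < ρ → ∀ (ω : (Fin n → ℝ) → ℝ), IsWeight ω →
      List.TFAE [
        ω ∈ AInftyLocAt n ρ,
        -- sublevel sets occupy a bounded proportion
        ∃ γ δ : ℝ, 0 < γ ∧ γ < 1 ∧ 0 < δ ∧ δ < 1 ∧
          ∀ Q : Set (Fin n → ℝ), IsCubeUpTo ρ Q →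
            volume {x ∈ Q | ENNReal.ofReal (ω x) ≤ ENNReal.ofReal γ * avg ω Q} ≤
              ENNReal.ofReal δ * volume Q,
        -- small Lebesgue proportion forces small weighted proportion
        ∃ α β : ℝ, 0 < α ∧ α < 1 ∧ 0 < β ∧ β < 1 ∧
          ∀ Q : Set (Fin n → ℝ), IsCubeUpTo ρ Q →
            ∀ A : Set (Fin n → ℝ), A ⊆ Q → NullMeasurableSet A volume →
              volume A ≤ ENNReal.ofReal α * volume Q → wt ω A ≤ ENNReal.ofReal β * wt ω Q,
        -- local reverse Hölder inequality
        ∃ C₁ ε : ℝ, 0 < C₁ ∧ 0 < ε ∧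
          ∀ Q : Set (Fin n → ℝ), IsCubeUpTo ρ Q →
            ((∫⁻ x in Q, ENNReal.ofReal (ω x) ^ (1 + ε)) / volume Q) ^ (1 / (1 + ε)) ≤
              ENNReal.ofReal C₁ * avg ω Q,
        -- power comparability
        ∃ C₂ ε₀ : ℝ, 0 < C₂ ∧ 0 < ε₀ ∧
          ∀ Q : Set (Fin n → ℝ), IsCubeUpTo ρ Q →
            ∀ A : Set (Fin n → ℝ), A ⊆ Q → NullMeasurableSet A volume →
              wt ω A / wt ω Q ≤ ENNReal.ofReal C₂ * (volume A / volume Q) ^ ε₀,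
        -- small weighted proportion forces small Lebesgue proportion
        ∃ α' β' : ℝ, 0 < α' ∧ α' < 1 ∧ 0 < β' ∧ β' < 1 ∧
          ∀ Q : Set (Fin n → ℝ), IsCubeUpTo ρ Q →
            ∀ A : Set (Fin n → ℝ), A ⊆ Q → NullMeasurableSet A volume →
              wt ω A < ENNReal.ofReal α' * wt ω Q → volume A < ENNReal.ofReal β' * volume Q,
        -- finite local Muckenhoupt constant at scale `ρ`
        ∃ p C₃ : ℝ, 1 ≤ p ∧ apConst p ρ ω ≤ ENNReal.ofReal C₃,
        -- membership in `A_p^loc`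
        ∃ p : ℝ, 1 ≤ p ∧ ω ∈ ApLoc n p]) ∧
    (∀ ρ : ℝ, 0 < ρ → AInftyLocAt n ρ = AInftyLoc n) ∧
    AInftyLoc n = ⋃ (p : ℝ) (_ : 1 ≤ p), ApLoc n p := by
  refine ⟨fun ρ hρ ω hω => ?_, fun ρ hρ => ?_, ?_⟩
  · tfae_have 1 → 2 := HasSmallSublevels.of_mem_aInfty
    tfae_have 2 → 3 := HasSmallSublevels.smallVolumeBoundsWeight hω
    tfae_have 3 → 4 := SmallVolumeBoundsWeight.hasReverseHolder hω
    tfae_have 4 → 5 := HasReverseHolder.hasPowerBound hω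
    tfae_have 5 → 6 := HasPowerBound.smallWeightBoundsVolume hω
    tfae_have 6 → 7 := SmallWeightBoundsVolume.exists_apConst_le hω
    tfae_have 7 → 1 := hω.mem_aInftyLocAt_of_apConst_le
    tfae_have 7 ↔ 8 := hω.exists_apConst_le_iff_exists_mem_apLoc hρ
    tfae_finish
  · ext ω
    exact (mem_aInftyLocAt_iff hρ).trans (mem_aInftyLocAt_iff one_pos).symm
  · ext ω
    simp only [Set.mem_iUnion, exists_prop]
    exact mem_aInftyLocAt_iff one_pos
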